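/- Let $E$ be an interval exchange transformation of $[0,1)$ on $N$ intervals $\Omega_1,\dots,\Omega_N$ of positive lengths $|\Omega_i|$ with sum $1$, with irreducible permutation and translations $\tau_i$ (so $E(x)=x+\tau_i$ on $\Omega_i$), and suppose that $E$ is uniquely ergodic. Suppose that $E$ is renormalizable with scaling ratio $\rho\in(0,1)$ and associated substitution $\sigma$ on $\{1,\dots,N\}$. That is, there is an interval $I=[a,a+\rho)\subset[0,1)$ such that $x\mapsto a+\rho x$ conjugates $E$ to the first return map of $E$ to $I$, and for every $i$ all points of $a+\rho\,\Omega_i$ visit, until their first return to $I$, the intervals $\Omega_j$ in the order given by the word $\sigma(i)$; the return time on $a+\rho\,\Omega_i$ is the length of $\sigma(i)$. Let $\mathcal M=\sum_i\mathbb Z|\Omega_i|$ be the module of $E$, let its rank $n$ be called the rank of $E$, and, for a $\mathbb Z$-basis $\nu_1,\dots,\nu_n$ of $\mathcal M$, let $v_i\in\mathbb Z^n$ be the coordinate vector of $\tau_i\in\mathcal M$. The drift vector is $\mathcal S=\sum_i|\Omega_i|\,v_i\in\mathbb R^n$. Then the incidence matrix of $\sigma$ is primitive, $\beta=\rho^{-1}$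 is its largest eigenvalue (an eigenvalue, larger in modulus than every other complex eigenvalue), and $\rho$ is a unit in the ring $\mathbb Z[\beta]$. The lengths $|\Omega_i|$ generate the field $\mathbb Q(\rho)$, which is a number field, and the rank $n$ is maximal, that is, equal to the degree of this field, which is the degree of $\rho$. Moreover, for every choice of the basis of $\mathcal M$: (i) if the drift vector is non-zero, then $n$ is even and $n\le N$; (ii) if the drift vector is zero, then $2n\le N$. -/

import Mathlib

open scoped IntermediateField

noncomputable section

/-- An interval exchange transformation of `[0, 1)` on `N` intervals: positive lengths with sum `1`
(from left to right), and an irreducible permutation; `perm i` is the position that the `i`-th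
interval takes after the exchange. -/
structure IET (N : ℕ) where
  length : Fin N → ℝ
  length_pos : ∀ i, 0 < length i
  sum_length : ∑ i, length i = 1
  perm : Equiv.Perm (Fin N)
  irreducible : ∀ k : ℕ, 0 < k → k < N →
    perm '' {i : Fin N | (i : ℕ) < k} ≠ {i : Fin N | (i : ℕ) < k}

namespace IET

variable {N : ℕ} (E : IET N)

/-- Left endpoint of the `i`-th interval before the exchange. -/
def left (i : Fin N) : ℝ := ∑ j with j < i, E.length j

/-- Left endpoint of the image of the `i`-th interval. -/
def imageLeft (i : Fin N) : ℝ := ∑ j with E.perm j < E.perm i, E.length j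

/-- The `i`-th interval of the partition of `[0, 1)`. -/
def atom (i : Fin N) : Set ℝ := Set.Ico (E.left i) (E.left i + E.length i)

/-- The `i`-th translation. -/
def translation (i : Fin N) : ℝ := E.imageLeft i - E.left i

/-- The map itself, `x ↦ x + τ_i` on the `i`-th interval (and the identity outside `[0, 1)`). -/
def map (x : ℝ) : ℝ := x + ∑ i, (E.atom i).indicator (fun _ => E.translation i) x

/-- There is exactly one invariant Borel probability measure on `[0, 1)`. -/
def UniquelyErgodic : Prop :=
  ∃! μ : MeasureTheory.Measure ℝ,
    MeasureTheory.IsProbabilityMeasure μ ∧ μ (Set.Ico 0 1)ᶜ = 0 ∧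
      MeasureTheory.MeasurePreserving E.map μ μ

/-- `r` is the first return time of the point `y` to the set `I`. -/
def IsFirstReturnTime (I : Set ℝ) (y : ℝ) (r : ℕ) : Prop :=
  0 < r ∧ E.map^[r] y ∈ I ∧ ∀ k, 0 < k → k < r → E.map^[k] y ∉ I

/-- `E` renormalizes on the proper subinterval `[a, a + ρ)` of `[0, 1)`, with scaling ratio `ρ` and
substitution `σ` on the alphabet `{1, …, N}`: the rescaling `x ↦ a + ρ x` conjugates `E` to the first
return map of `E` to `[a, a + ρ)`, and every point of the rescaled `i`-th interval visits, up to its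
return, the intervals of the partition in the order given by the word `σ i`. -/
structure IsRenormalization (ρ a : ℝ) (σ : Fin N → List (Fin N)) : Prop where
  ratio_pos : 0 < ρ
  ratio_lt_one : ρ < 1
  left_nonneg : 0 ≤ a
  right_le_one : a + ρ ≤ 1
  firstReturn : ∀ i, ∀ x ∈ E.atom i,
    E.IsFirstReturnTime (Set.Ico a (a + ρ)) (a + ρ * x) (σ i).length
  conj : ∀ i, ∀ x ∈ E.atom i, E.map^[(σ i).length] (a + ρ * x) = a + ρ * E.map x
  coding : ∀ i, ∀ x ∈ E.atom i, ∀ (k : ℕ) (hk : k < (σ i).length),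
    E.map^[k] (a + ρ * x) ∈ E.atom ((σ i)[k])

/-- The module of `E`: integral linear combinations of the lengths. -/
def lengthModule : Submodule ℤ ℝ := Submodule.span ℤ (Set.range E.length)

/-- The rank of `E`. -/
def rank : ℕ := Module.finrank ℤ E.lengthModule

/-- The field generated by the lengths. -/
def lengthField : IntermediateField ℚ ℝ := IntermediateField.adjoin ℚ (Set.range E.length)

/-- The lengths generate a number field, and the rank of `E` attains the degree of that field. -/
def HasMaximalRank : Prop :=
  FiniteDimensional ℚ E.lengthField ∧ E.rank = Module.finrank ℚ E.lengthField

theorem translation_mem (i : Fin N) : E.translation i ∈ E.lengthModule :=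
  sub_mem
    (sum_mem fun _ _ => Submodule.subset_span (Set.mem_range_self _))
    (sum_mem fun _ _ => Submodule.subset_span (Set.mem_range_self _))

/-- The drift vector `∑ i, |Ω_i| v_i`, where `v_i` is the integer coordinate vector of the `i`-th
translation in the basis `b` of the module of `E`. -/
def drift {n : ℕ} (b : Module.Basis (Fin n) ℤ E.lengthModule) : Fin n → ℝ :=
  ∑ i, E.length i • fun k => (b.repr ⟨E.translation i, E.translation_mem i⟩ k : ℝ)

end IET

/-- The incidence matrix of a substitution: the entry `(j, i)` is the number of occurrences of the
letter `j` in the word `σ i`. -/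
def incidenceMatrix {N : ℕ} (σ : Fin N → List (Fin N)) : Matrix (Fin N) (Fin N) ℤ :=
  Matrix.of fun j i => ((σ i).count j : ℤ)

/-- `β` is an eigenvalue of `M`, larger in modulus than every other complex eigenvalue. -/
def IsLargestEigenvalue {N : ℕ} (M : Matrix (Fin N) (Fin N) ℤ) (β : ℝ) : Prop :=
  Module.End.HasEigenvalue (Matrix.toLin' (M.map (Int.cast : ℤ → ℝ))) β ∧
    ∀ μ : ℂ, Module.End.HasEigenvalue (Matrix.toLin' (M.map (Int.cast : ℤ → ℂ))) μ →
      μ ≠ (β : ℂ) → ‖μ‖ < β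

end

/-!
Write `ρ` for the scaling ratio, `β = ρ⁻¹`, `M` for the incidence matrix, `l` for the vector of
lengths and `τ` for the vector of translations.

*Dynamics.* For a uniquely ergodic exchange Lebesgue measure on `[0, 1)` is ergodic. Cutting an
interval `[c, d)` at the finitely many points whose orbits run into an endpoint before returning,
Poincaré recurrence shows that the return times to `[c, d)` are bounded. Hence the points that reach
`[c, d)` within this bound form a forward invariant set; it has full measure by ergodicity, and is
everything since the map is locally a translation to the right. So each interval is visited within
bounded time (`IET.UniquelyErgodic.exists_bounded_visit`), and in particular there are no periodic
points. The floors of the towers over the rescaled intervals therefore partition `[0, 1)`, which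
gives `M l = β l` (`IET.IsRenormalization.length_eq_sum`); comparing displacements gives
`Mᵀ τ = ρ τ` (`IET.IsRenormalization.ratio_mul_translation`). The towers over the intervals of
level `k` become arbitrarily high as `k` grows, because without periodic points a bounded return
time would force a minimal displacement; a tower that is high enough visits every interval of the
partition, so `M` is primitive (`IET.IsRenormalization.isPrimitive`).

*Algebra.* The positive eigenvector `l` makes `β` the largest eigenvalue, with one-dimensional
eigenspace, whence `l` lies in `ℚ(ρ)`. As `ρ` is an eigenvalue of `Mᵀ` it is an algebraic integer,
so that it belongs to `ℤ[β]`. The rational spans of `l` and of `τ` are stable under `β` and under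
`ρ` respectively, so both equal `K = ℚ(ρ)`; this gives the rank.

*Drift.* The drift vector lists the values of the map `f ↦ ∑ f(τ_i) l_i` from the rational dual of
`K` to `K` on a dual basis (`driftMap`). The two eigenvector equations make the kernel of this map a
`K`-subspace of the dual, which is one-dimensional over `K`; so the map is injective or zero. It is
alternating, since `τ` is the image of `l` under an antisymmetric integer matrix. If it is
injective, it is a nondegenerate alternating form, so `[K : ℚ]` is even. If it is zero, then the
functionals evaluated on `l` and on `τ` give two orthogonal subspaces of `ℚ ^ N`, each of dimension
`[K : ℚ]`.
-/

noncomputable section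

namespace IET

variable {N : ℕ} (E : IET N)

open MeasureTheory Set Filter Topology

/-! ### The partitions of the unit interval and the bijectivity of the map -/

/-- The left endpoint of the `i`-th interval after laying the intervals out in the order given by
the permutation `f`; `f = 1` gives `IET.left` and `f = E.perm` gives `IET.imageLeft`. -/
def orderedLeft (f : Equiv.Perm (Fin N)) (i : Fin N) : ℝ := ∑ j with f j < f i, E.length j

lemma orderedLeft_nonneg (f : Equiv.Perm (Fin N)) (i : Fin N) : 0 ≤ E.orderedLeft f i :=
  Finset.sum_nonneg fun j _ => (E.length_pos j).le

lemma orderedLeft_add_length (f : Equiv.Perm (Fin N)) (i : Fin N) :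
    E.orderedLeft f i + E.length i = ∑ j with f j ≤ f i, E.length j := by
  have : (Finset.univ.filter fun j => f j ≤ f i) =
      insert i (Finset.univ.filter fun j => f j < f i) := by
    ext j
    simp [le_iff_lt_or_eq, or_comm]
  rw [this, Finset.sum_insert (by simp), orderedLeft, add_comm]

lemma orderedLeft_add_length_le_one (f : Equiv.Perm (Fin N)) (i : Fin N) :
    E.orderedLeft f i + E.length i ≤ 1 := by
  rw [orderedLeft_add_length, ← E.sum_length]
  exact Finset.sum_le_sum_of_subset_of_nonneg (Finset.filter_subset _ _)
    fun j _ _ => (E.length_pos j).le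

lemma orderedLeft_add_length_le (f : Equiv.Perm (Fin N)) {i j : Fin N} (h : f i < f j) :
    E.orderedLeft f i + E.length i ≤ E.orderedLeft f j := by
  rw [orderedLeft_add_length]
  refine Finset.sum_le_sum_of_subset_of_nonneg ?_ fun j _ _ => (E.length_pos j).le
  intro k hk
  simp only [Finset.mem_filter, Finset.mem_univ, true_and] at hk ⊢
  exact hk.trans_lt h

lemma exists_mem_Ico_orderedLeft (f : Equiv.Perm (Fin N)) {x : ℝ} (hx : x ∈ Ico (0 : ℝ) 1) :
    ∃ i, x ∈ Ico (E.orderedLeft f i) (E.orderedLeft f i + E.length i) := by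
  have key : ∀ n : ℕ, n ≤ N → x < ∑ j with (f j : ℕ) < n, E.length j →
      ∃ i, x ∈ Ico (E.orderedLeft f i) (E.orderedLeft f i + E.length i) := by
    intro n
    induction n with
    | zero => intro _ h; simp at h; exact absurd hx.1 (not_le.mpr h)
    | succ n ih =>
      intro hn h
      by_cases hlt : x < ∑ j with (f j : ℕ) < n, E.length j
      · exact ih (by omega) hlt
      · set i := f.symm ⟨n, hn⟩ with hi
        have hfi : f i = ⟨n, hn⟩ := by simp [hi]
        refine ⟨i, ?_, ?_⟩
        · simpa [orderedLeft, Fin.lt_def, hfi] using hlt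
        · rw [orderedLeft_add_length]
          simpa [Fin.le_def, hfi, Nat.lt_succ_iff] using h
  refine key N le_rfl ?_
  have : (Finset.univ.filter fun j => (f j : ℕ) < N) = Finset.univ := by
    ext j; simp
  rw [this, E.sum_length]
  exact hx.2

lemma eq_of_mem_Ico_orderedLeft (f : Equiv.Perm (Fin N)) {x : ℝ} {i j : Fin N}
    (hi : x ∈ Ico (E.orderedLeft f i) (E.orderedLeft f i + E.length i))
    (hj : x ∈ Ico (E.orderedLeft f j) (E.orderedLeft f j + E.length j)) : i = j := by
  rcases lt_trichotomy (f i) (f j) with h | h | h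
  · have := E.orderedLeft_add_length_le f h
    exact absurd (hi.2.trans_le (this.trans hj.1)) (lt_irrefl _)
  · exact f.injective h
  · have := E.orderedLeft_add_length_le f h
    exact absurd (hj.2.trans_le (this.trans hi.1)) (lt_irrefl _)

/-- The image of the `i`-th interval of the partition under the exchange. -/
def imageAtom (i : Fin N) : Set ℝ := Ico (E.imageLeft i) (E.imageLeft i + E.length i)

lemma exists_mem_atom {x : ℝ} (hx : x ∈ Ico (0 : ℝ) 1) : ∃ i, x ∈ E.atom i :=
  E.exists_mem_Ico_orderedLeft 1 hx

lemma exists_mem_imageAtom {x : ℝ} (hx : x ∈ Ico (0 : ℝ) 1) : ∃ i, x ∈ E.imageAtom i :=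
  E.exists_mem_Ico_orderedLeft E.perm hx

variable {E} in
lemma eq_of_mem_atom {x : ℝ} {i j : Fin N} (hi : x ∈ E.atom i) (hj : x ∈ E.atom j) : i = j :=
  E.eq_of_mem_Ico_orderedLeft 1 hi hj

variable {E} in
lemma eq_of_mem_imageAtom {x : ℝ} {i j : Fin N} (hi : x ∈ E.imageAtom i)
    (hj : x ∈ E.imageAtom j) : i = j :=
  E.eq_of_mem_Ico_orderedLeft E.perm hi hj

lemma atom_subset (i : Fin N) : E.atom i ⊆ Ico 0 1 :=
  Ico_subset_Ico (E.orderedLeft_nonneg 1 i) (E.orderedLeft_add_length_le_one 1 i)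

lemma imageAtom_subset (i : Fin N) : E.imageAtom i ⊆ Ico 0 1 :=
  Ico_subset_Ico (E.orderedLeft_nonneg E.perm i) (E.orderedLeft_add_length_le_one E.perm i)

lemma left_mem_atom (i : Fin N) : E.left i ∈ E.atom i :=
  ⟨le_rfl, lt_add_of_pos_right _ (E.length_pos i)⟩

lemma iUnion_atom : ⋃ i, E.atom i = Ico 0 1 :=
  Subset.antisymm (iUnion_subset E.atom_subset) fun _ hx => mem_iUnion.2 (E.exists_mem_atom hx)

lemma iUnion_imageAtom : ⋃ i, E.imageAtom i = Ico 0 1 :=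
  Subset.antisymm (iUnion_subset E.imageAtom_subset)
    fun _ hx => mem_iUnion.2 (E.exists_mem_imageAtom hx)

lemma pairwise_disjoint_atom : Pairwise (Function.onFun Disjoint E.atom) := fun _ _ hij =>
  Set.disjoint_left.2 fun _ hi hj => hij (eq_of_mem_atom hi hj)

lemma pairwise_disjoint_imageAtom : Pairwise (Function.onFun Disjoint E.imageAtom) :=
  fun _ _ hij => Set.disjoint_left.2 fun _ hi hj => hij (eq_of_mem_imageAtom hi hj)

lemma measurableSet_atom (i : Fin N) : MeasurableSet (E.atom i) := measurableSet_Ico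

lemma measurable_map : Measurable E.map :=
  measurable_id.add (Finset.measurable_sum _ fun i _ =>
    measurable_const.indicator (E.measurableSet_atom i))

variable {E} in
lemma map_of_mem_atom {x : ℝ} {i : Fin N} (hx : x ∈ E.atom i) :
    E.map x = x + E.translation i := by
  rw [map, Finset.sum_eq_single i]
  · rw [indicator_of_mem hx]
  · intro j _ hj
    exact indicator_of_notMem (fun h => hj (eq_of_mem_atom h hx)) _
  · simp

variable {E} in
lemma map_mem_imageAtom {x : ℝ} {i : Fin N} (hx : x ∈ E.atom i) : E.map x ∈ E.imageAtom i := by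
  have h := hx
  simp only [atom, mem_Ico] at h
  rw [map_of_mem_atom hx]
  simp only [imageAtom, translation, mem_Ico]
  constructor <;> linarith [h.1, h.2]

variable {E} in
lemma map_mem {x : ℝ} (hx : x ∈ Ico (0 : ℝ) 1) : E.map x ∈ Ico (0 : ℝ) 1 := by
  obtain ⟨i, hi⟩ := E.exists_mem_atom hx
  exact E.imageAtom_subset i (map_mem_imageAtom hi)

variable {E} in
lemma iterate_mem {x : ℝ} (hx : x ∈ Ico (0 : ℝ) 1) (k : ℕ) : E.map^[k] x ∈ Ico (0 : ℝ) 1 := by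
  induction k with
  | zero => exact hx
  | succ k ih => rw [Function.iterate_succ_apply']; exact map_mem ih

lemma map_injOn : InjOn E.map (Ico 0 1) := by
  intro x hx y hy hxy
  obtain ⟨i, hi⟩ := E.exists_mem_atom hx
  obtain ⟨j, hj⟩ := E.exists_mem_atom hy
  have hij : i = j := eq_of_mem_imageAtom (map_mem_imageAtom hi) (hxy ▸ map_mem_imageAtom hj)
  subst hij
  rw [map_of_mem_atom hi, map_of_mem_atom hj] at hxy
  linarith

lemma map_surjOn : SurjOn E.map (Ico 0 1) (Ico 0 1) := by
  intro y hy
  obtain ⟨i, hi⟩ := E.exists_mem_imageAtom hy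
  simp only [imageAtom, mem_Ico] at hi
  have hx : y - E.translation i ∈ E.atom i := by
    simp only [atom, translation, mem_Ico]
    constructor <;> linarith [hi.1, hi.2]
  exact ⟨_, E.atom_subset i hx, by rw [map_of_mem_atom hx]; ring⟩

variable {E} in
lemma iterate_inj {x y : ℝ} (hx : x ∈ Ico (0 : ℝ) 1) (hy : y ∈ Ico (0 : ℝ) 1) (k : ℕ)
    (h : E.map^[k] x = E.map^[k] y) : x = y := by
  induction k with
  | zero => exact h
  | succ k ih =>
    rw [Function.iterate_succ_apply', Function.iterate_succ_apply'] at h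
    exact ih (E.map_injOn (iterate_mem hx k) (iterate_mem hy k) h)

lemma exists_iterate_eq {x : ℝ} (hx : x ∈ Ico (0 : ℝ) 1) (k : ℕ) :
    ∃ y ∈ Ico (0 : ℝ) 1, E.map^[k] y = x := by
  induction k generalizing x with
  | zero => exact ⟨x, hx, rfl⟩
  | succ k ih =>
    obtain ⟨z, hz, rfl⟩ := E.map_surjOn hx
    obtain ⟨y, hy, rfl⟩ := ih hz
    exact ⟨y, hy, Function.iterate_succ_apply' _ _ _⟩

/-- Every iterate of the map is a translation on a right neighbourhood of each point. -/
lemma eventually_iterate_add {x : ℝ} (hx : x ∈ Ico (0 : ℝ) 1) (k : ℕ) :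
    ∀ᶠ t in 𝓝[>] (0 : ℝ), E.map^[k] (x + t) = E.map^[k] x + t := by
  induction k with
  | zero => simp
  | succ k ih =>
    obtain ⟨i, hi⟩ := E.exists_mem_atom (iterate_mem hx k)
    have h2 : ∀ᶠ t in 𝓝[>] (0 : ℝ), E.map^[k] x + t ∈ E.atom i := by
      have hpos : 0 < E.left i + E.length i - E.map^[k] x := by linarith [hi.2]
      filter_upwards [Ioo_mem_nhdsGT hpos] with t ht
      exact ⟨by linarith [hi.1, ht.1], by linarith [ht.2]⟩
    filter_upwards [ih, h2] with t h1 h2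
    rw [Function.iterate_succ_apply', Function.iterate_succ_apply', h1, map_of_mem_atom h2,
      map_of_mem_atom hi]
    ring

/-! ### Lebesgue measure is invariant, hence ergodic -/

lemma map_mem_iff_of_mem_atom {i : Fin N} {x : ℝ} (A : Set ℝ) (hx : x ∈ E.atom i) :
    E.map x ∈ A ↔ x + E.translation i ∈ A ∩ E.imageAtom i := by
  have := map_mem_imageAtom hx
  rw [map_of_mem_atom hx] at this ⊢
  exact ⟨fun h => ⟨h, this⟩, fun h => h.1⟩

lemma measurePreserving_map :
    MeasurePreserving E.map (volume.restrict (Ico (0 : ℝ) 1))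
      (volume.restrict (Ico (0 : ℝ) 1)) := by
  refine ⟨E.measurable_map, ?_⟩
  ext A hA
  rw [Measure.map_apply E.measurable_map hA, Measure.restrict_apply (E.measurable_map hA),
    Measure.restrict_apply hA]
  nth_rewrite 1 [← E.iUnion_atom]
  rw [← E.iUnion_imageAtom, inter_iUnion, inter_iUnion, measure_iUnion, measure_iUnion]
  · congr 1
    ext i
    have : E.map ⁻¹' A ∩ E.atom i =
        (fun x => x + E.translation i) ⁻¹' (A ∩ E.imageAtom i) := by
      ext x
      constructor
      · rintro ⟨h1, h2⟩
        exact (E.map_mem_iff_of_mem_atom A h2).1 h1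
      · intro h
        have hx : x ∈ E.atom i := by
          have := h.2
          simp only [imageAtom, translation, mem_Ico] at this
          simp only [atom, mem_Ico]
          constructor <;> linarith [this.1, this.2]
        exact ⟨(E.map_mem_iff_of_mem_atom A hx).2 h, hx⟩
    rw [this, measure_preimage_add_right]
  · exact fun i j hij => (E.pairwise_disjoint_imageAtom hij).mono inter_subset_right
      inter_subset_right
  · exact fun i => hA.inter measurableSet_Ico
  · exact fun i j hij => (E.pairwise_disjoint_atom hij).mono inter_subset_right
      inter_subset_right
  · exact fun i => (E.measurable_map hA).inter measurableSet_Ico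

instance isProbabilityMeasure_restrict_Ico :
    IsProbabilityMeasure (volume.restrict (Ico (0 : ℝ) 1)) := ⟨by simp⟩

variable {E} in
/-- A uniquely ergodic exchange is ergodic for Lebesgue measure, the unique invariant probability
measure being an extreme point of the set of invariant ones. -/
lemma UniquelyErgodic.ergodic (hE : E.UniquelyErgodic) :
    Ergodic E.map (volume.restrict (Ico (0 : ℝ) 1)) := by
  set μ := volume.restrict (Ico (0 : ℝ) 1) with hμ
  have hμc : μ (Ico 0 1)ᶜ = 0 := by
    rw [hμ, Measure.restrict_apply measurableSet_Ico.compl]; simp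
  refine Ergodic.of_mem_extremePoints ?_
  rw [mem_extremePoints_iff_left]
  refine ⟨⟨E.measurePreserving_map, inferInstance⟩, ?_⟩
  rintro ν₁ ⟨h1, hp1⟩ ν₂ ⟨h2, hp2⟩ ⟨a, b, ha, hb, hab, hsum⟩
  refine hE.unique ⟨hp1, ?_, h1⟩ ⟨inferInstance, hμc, E.measurePreserving_map⟩
  have h0 : (a • ν₁ + b • ν₂) (Ico 0 1)ᶜ = 0 := by rw [hsum]; exact hμc
  simp only [Measure.coe_add, Measure.coe_smul, Pi.add_apply, Pi.smul_apply, smul_eq_mul,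
    add_eq_zero, mul_eq_zero] at h0
  exact h0.1.resolve_left ha.ne'

/-! ### Bounded return times to an interval -/

/-- The endpoints of `[c, d)` and of the intervals of the partition. -/
def endpoints (c d : ℝ) : Set ℝ := insert c (insert d (range E.left))

/-- The points of `(c, d)` whose forward orbit meets an endpoint before it returns to `(c, d)`.
They cut `[c, d)` into intervals on which the first return map is a translation. -/
def returnCuts (c d : ℝ) : Set ℝ :=
  {q ∈ Ioo c d | ∃ s, E.map^[s] q ∈ E.endpoints c d ∧
    ∀ s', 0 < s' → s' ≤ s → E.map^[s'] q ∉ Ioo c d}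

/-- An endpoint determines the cut that reaches it, as the last point of `(c, d)` on its backward
orbit; so there are only finitely many cuts. -/
lemma finite_returnCuts {c d : ℝ} (hc : 0 ≤ c) (hd : d ≤ 1) : (E.returnCuts c d).Finite := by
  have hP : (E.endpoints c d).Finite := ((finite_range _).insert _).insert _
  choose! s hs hs' using fun q (hq : q ∈ E.returnCuts c d) => hq.2
  have hmem : ∀ q ∈ E.returnCuts c d, q ∈ Ico (0 : ℝ) 1 := fun q hq =>
    ⟨hc.trans hq.1.1.le, hq.1.2.trans_le hd⟩
  refine Finite.of_finite_image (f := fun q => E.map^[s q] q) (hP.subset ?_) ?_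
  · rintro _ ⟨q, hq, rfl⟩
    exact hs q hq
  · have aux : ∀ p ∈ E.returnCuts c d, ∀ q ∈ E.returnCuts c d, s p ≤ s q →
        E.map^[s p] p = E.map^[s q] q → p = q := by
      intro p hp q hq hle h
      obtain ⟨m, hm⟩ := Nat.exists_eq_add_of_le hle
      rw [hm, Function.iterate_add_apply] at h
      have h := iterate_inj (hmem p hp) (iterate_mem (hmem q hq) m) _ h
      rcases Nat.eq_zero_or_pos m with rfl | hpos
      · exact h
      · exact absurd (h ▸ hp.1) (hs' q hq m hpos (by omega))
    intro p hp q hq h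
    rcases le_total (s p) (s q) with hle | hle
    · exact aux p hp q hq hle h
    · exact (aux q hq p hp hle h.symm).symm

/-- An interval without interior partition endpoints lies in one interval of the partition. -/
lemma exists_Ico_subset_atom {u v : ℝ} (hu : 0 ≤ u) (huv : u < v) (hv : v ≤ 1)
    (h : ∀ i, E.left i ∉ Ioo u v) : ∃ i, Ico u v ⊆ E.atom i := by
  obtain ⟨i, hi⟩ := E.exists_mem_atom (x := u) ⟨hu, huv.trans_le hv⟩
  refine ⟨i, fun y hy => ?_⟩
  obtain ⟨j, hj⟩ := E.exists_mem_atom (x := y) ⟨hu.trans hy.1, hy.2.trans_le hv⟩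
  have hju : E.left j ≤ u := by
    by_contra hlt
    exact h j ⟨not_le.1 hlt, hj.1.trans_lt hy.2⟩
  have : u ∈ E.atom j := ⟨hju, hy.1.trans_lt hj.2⟩
  rwa [eq_of_mem_atom hi this]

/-- As long as an interval between cuts has not come back, it moves by a translation, and it then
either lies in `[c, d)` or misses it. -/
lemma exists_translation_of_no_return {c d u v : ℝ} (hc : 0 ≤ c) (hd : d ≤ 1)
    (hcu : c ≤ u) (huv : u < v) (hvd : v ≤ d) (hcut : ∀ q ∈ Ioo u v, q ∉ E.returnCuts c d)
    (n : ℕ) (hn : ∀ k, 0 < k → k ≤ n → ∀ y ∈ Ico u v, E.map^[k] y ∉ Ico c d) :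
    ∃ t, (∀ y ∈ Ico u v, E.map^[n + 1] y = y + t) ∧
      ((∀ y ∈ Ico u v, y + t ∈ Ico c d) ∨ (∀ y ∈ Ico u v, y + t ∉ Ico c d)) := by
  have hcut' : ∀ m ≤ n + 1, ∀ y ∈ Ioo u v, E.map^[m] y ∈ E.endpoints c d →
      E.map^[m] y ∈ Ioo c d := by
    intro m hm y hy he
    by_contra hnot
    refine hcut y hy ⟨⟨hcu.trans_lt hy.1, hy.2.trans_le hvd⟩, m, he, fun s' h0 hs' => ?_⟩
    rcases hs'.eq_or_lt with rfl | hlt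
    · exact hnot
    · exact fun h => hn s' h0 (by omega) y ⟨hy.1.le, hy.2⟩ ⟨h.1.le, h.2⟩
  have htrans : ∀ m ≤ n + 1, ∃ t, ∀ y ∈ Ico u v, E.map^[m] y = y + t := by
    intro m
    induction m with
    | zero => exact fun _ => ⟨0, fun y _ => by simp⟩
    | succ m ih =>
      intro hm
      obtain ⟨t, ht⟩ := ih (by omega)
      have hin : ∀ y ∈ Ico u v, y + t ∈ Ico (0 : ℝ) 1 := fun y hy => by
        rw [← ht y hy]
        exact iterate_mem ⟨(hc.trans hcu).trans hy.1, hy.2.trans_le (hvd.trans hd)⟩ m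
      have hvt : v + t ≤ 1 := by
        refine le_of_forall_lt fun z hz => ?_
        have h1 : max u (z - t) ∈ Ico u v := ⟨le_max_left _ _, max_lt huv (by linarith)⟩
        have := (hin _ h1).2
        linarith [le_max_right u (z - t)]
      obtain ⟨i, hi⟩ := E.exists_Ico_subset_atom (u := u + t) (v := v + t)
        (hin u ⟨le_rfl, huv⟩).1 (by linarith) hvt (by
          intro i hi
          have hy : E.left i - t ∈ Ioo u v := ⟨by linarith [hi.1], by linarith [hi.2]⟩
          have hmy := ht _ ⟨hy.1.le, hy.2⟩
          rw [sub_add_cancel] at hmy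
          rcases Nat.eq_zero_or_pos m with rfl | hpos
          · refine hcut _ hy ⟨⟨hcu.trans_lt hy.1, hy.2.trans_le hvd⟩, 0, ?_, fun s' h0 h => ?_⟩
            · rw [hmy]; exact Or.inr (Or.inr ⟨i, rfl⟩)
            · omega
          · have := hcut' m (by omega) _ hy (by rw [hmy]; exact Or.inr (Or.inr ⟨i, rfl⟩))
            exact hn m hpos (by omega) _ ⟨hy.1.le, hy.2⟩ ⟨this.1.le, this.2⟩)
      refine ⟨t + E.translation i, fun y hy => ?_⟩
      rw [Function.iterate_succ_apply', ht y hy,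
        map_of_mem_atom (hi ⟨by linarith [hy.1], by linarith [hy.2]⟩)]
      ring
  obtain ⟨t, ht⟩ := htrans (n + 1) le_rfl
  refine ⟨t, ht, ?_⟩
  have hend : ∀ p, p ∈ E.endpoints c d → p ∉ Ioo c d → p ∉ Ioo (u + t) (v + t) := by
    intro p hp hp' hpt
    have hy : p - t ∈ Ioo u v := ⟨by linarith [hpt.1], by linarith [hpt.2]⟩
    have hmy := ht _ ⟨hy.1.le, hy.2⟩
    rw [sub_add_cancel] at hmy
    have := hcut' (n + 1) le_rfl _ hy (by rwa [hmy])
    exact hp' (by rwa [hmy] at this)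
  have h1 := hend c (Or.inl rfl) (by simp)
  have h2 := hend d (Or.inr (Or.inl rfl)) (by simp)
  simp only [mem_Ioo, not_and_or, not_lt] at h1 h2
  by_cases hmeet : c ≤ u + t ∧ u + t < d
  · refine Or.inl fun y hy => ⟨by linarith [hy.1, hmeet.1], ?_⟩
    rcases h2 with h2 | h2
    · linarith [hmeet.2]
    · linarith [hy.2]
  · refine Or.inr fun y hy hyt => hmeet ⟨?_, by linarith [hy.1, hyt.2]⟩
    rcases h1 with h1 | h1
    · exact h1
    · linarith [hy.2, hyt.1]

/-- By Poincaré recurrence an interval between cuts returns, and then it does so as a whole. -/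
lemma exists_return_of_no_cut {c d u v : ℝ} (hc : 0 ≤ c) (hd : d ≤ 1)
    (hcu : c ≤ u) (huv : u < v) (hvd : v ≤ d) (hcut : ∀ q ∈ Ioo u v, q ∉ E.returnCuts c d) :
    ∃ r, 0 < r ∧ ∀ y ∈ Ico u v, E.map^[r] y ∈ Ico c d := by
  have hμ : volume.restrict (Ico (0 : ℝ) 1) (Ico u v) ≠ 0 := by
    rw [Measure.restrict_apply measurableSet_Ico, inter_eq_left.2 (Ico_subset_Ico
      (hc.trans hcu) (hvd.trans hd)), Real.volume_Ico]
    simpa using huv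
  obtain ⟨x, hx, m, hm, hmx⟩ :=
    E.measurePreserving_map.conservative.exists_mem_iterate_mem
      measurableSet_Ico.nullMeasurableSet hμ
  have hex : ∃ k, 0 < k ∧ ∃ y ∈ Ico u v, E.map^[k] y ∈ Ico c d :=
    ⟨m, Nat.pos_of_ne_zero hm, x, hx, Ico_subset_Ico hcu hvd hmx⟩
  classical
  obtain ⟨h0, y, hy, hyr⟩ := Nat.find_spec hex
  obtain ⟨n, hn⟩ := Nat.exists_eq_succ_of_ne_zero h0.ne'
  obtain ⟨t, ht, hor⟩ := E.exists_translation_of_no_return hc hd hcu huv hvd hcut n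
    (fun k hk hkn y hy hmem => Nat.find_min hex (m := k) (by omega) ⟨hk, y, hy, hmem⟩)
  refine ⟨Nat.find hex, h0, fun z hz => ?_⟩
  rw [hn] at hyr ⊢
  rw [Nat.succ_eq_add_one, ht _ hz]
  rw [Nat.succ_eq_add_one, ht _ hy] at hyr
  exact hor.resolve_right (fun h => h y hy hyr) z hz

lemma exists_bounded_return {c d : ℝ} (hc : 0 ≤ c) (hd : d ≤ 1) :
    ∃ R, ∀ y ∈ Ico c d, ∃ r, 0 < r ∧ r ≤ R ∧ E.map^[r] y ∈ Ico c d := by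
  classical
  set F : Finset ℝ := insert c (insert d (E.finite_returnCuts hc hd).toFinset) with hF
  have hex : ∀ p : ℝ × ℝ, ∃ r, c ≤ p.1 → p.1 < p.2 → p.2 ≤ d →
      (∀ q ∈ Ioo p.1 p.2, q ∉ E.returnCuts c d) →
      0 < r ∧ ∀ y ∈ Ico p.1 p.2, E.map^[r] y ∈ Ico c d := by
    intro p
    by_cases h : c ≤ p.1 ∧ p.1 < p.2 ∧ p.2 ≤ d ∧ ∀ q ∈ Ioo p.1 p.2, q ∉ E.returnCuts c d
    · obtain ⟨r, hr⟩ := E.exists_return_of_no_cut hc hd h.1 h.2.1 h.2.2.1 h.2.2.2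
      exact ⟨r, fun _ _ _ _ => hr⟩
    · exact ⟨0, fun h1 h2 h3 h4 => absurd ⟨h1, h2, h3, h4⟩ h⟩
  choose r hr using hex
  refine ⟨(F ×ˢ F).sup r, fun y hy => ?_⟩
  -- `[u, v)` is the interval between consecutive cuts that contains `y`.
  obtain ⟨u, hu, humax⟩ := (F.filter (· ≤ y)).exists_max_image id
    ⟨c, by simp [hF, hy.1]⟩
  obtain ⟨v, hv, hvmin⟩ := (F.filter (y < ·)).exists_min_image id
    ⟨d, by simp [hF, hy.2]⟩
  rw [Finset.mem_filter] at hu hv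
  have hcu : c ≤ u := humax c (by simp [hF, hy.1])
  have hvd : v ≤ d := hvmin d (by simp [hF, hy.2])
  obtain ⟨h0, h⟩ := hr (u, v) hcu (hu.2.trans_lt hv.2) hvd (by
    intro q hq hqc
    have hqF : q ∈ F := by simp [hF, hqc]
    rcases le_or_gt q y with hle | hlt
    · exact absurd (humax q (by simp [hqF, hle])) (not_le.2 hq.1)
    · exact absurd (hvmin q (by simp [hqF, hlt])) (not_le.2 hq.2))
  exact ⟨r (u, v), h0, Finset.le_sup (Finset.mk_mem_product hu.1 hv.1), h y ⟨hu.2, hv.2⟩⟩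

/-! ### Minimality -/

variable {E} in
/-- Every orbit of a uniquely ergodic exchange visits `[c, d)` within bounded time: the set of
points that do so is forward invariant, so by ergodicity it has full measure, and its complement
contains a right neighbourhood of each of its points. -/
theorem UniquelyErgodic.exists_bounded_visit (hE : E.UniquelyErgodic) {c d : ℝ} (hc : 0 ≤ c)
    (hcd : c < d) (hd : d ≤ 1) :
    ∃ R, ∀ x ∈ Ico (0 : ℝ) 1, ∃ k ≤ R, E.map^[k] x ∈ Ico c d := by
  obtain ⟨R, hR⟩ := E.exists_bounded_return hc hd
  refine ⟨R, ?_⟩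
  set V : Set ℝ := ⋃ k ∈ Finset.range (R + 1), E.map^[k] ⁻¹' Ico c d with hV
  have hVmem : ∀ x, x ∈ V ↔ ∃ k ≤ R, E.map^[k] x ∈ Ico c d := by
    intro x
    simp only [hV, mem_iUnion, Finset.mem_range, Nat.lt_succ_iff, exists_prop, mem_preimage]
  have hVmeas : MeasurableSet V := Finset.measurableSet_biUnion _ fun k _ =>
    (E.measurable_map.iterate k) measurableSet_Ico
  have hfwd : V ⊆ E.map ⁻¹' V := by
    intro x hx
    rw [hVmem] at hx
    obtain ⟨k, hk, hkx⟩ := hx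
    rw [mem_preimage, hVmem]
    cases k with
    | zero =>
      obtain ⟨r, h0, hr, hrx⟩ := hR x hkx
      refine ⟨r - 1, by omega, ?_⟩
      rwa [← Function.iterate_succ_apply, Nat.succ_eq_add_one, Nat.sub_add_cancel h0]
    | succ k => exact ⟨k, by omega, hkx⟩
  have hpos : volume.restrict (Ico (0 : ℝ) 1) V ≠ 0 := by
    have hsub : Ico c d ⊆ V := fun x hx => (hVmem x).2 ⟨0, Nat.zero_le _, hx⟩
    refine fun h0 => absurd (measure_mono_null hsub h0) ?_
    rw [Measure.restrict_apply measurableSet_Ico, inter_eq_left.2 (Ico_subset_Ico hc hd),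
      Real.volume_Ico]
    simpa using hcd
  have hnull : volume (Vᶜ ∩ Ico (0 : ℝ) 1) = 0 := by
    rw [← Measure.restrict_apply hVmeas.compl]
    rcases hE.ergodic.ae_empty_or_univ_of_ae_le_preimage hVmeas.nullMeasurableSet
      (LE.le.eventuallyLE hfwd) with h | h
    · exact absurd (ae_eq_empty.1 h) hpos
    · exact ae_eq_univ.1 h
  intro x hx
  rw [← hVmem]
  by_contra hxV
  have hev : ∀ᶠ t in 𝓝[>] (0 : ℝ), x + t ∈ Vᶜ ∩ Ico (0 : ℝ) 1 := by
    have h1 : ∀ᶠ t in 𝓝[>] (0 : ℝ), ∀ k ∈ Finset.range (R + 1), E.map^[k] (x + t) ∉ Ico c d := by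
      rw [Filter.eventually_all_finset]
      intro k hk
      have hk' : E.map^[k] x ∉ Ico c d := fun h =>
        hxV ((hVmem x).2 ⟨k, by simpa [Nat.lt_succ_iff] using hk, h⟩)
      have h2 : ∀ᶠ t in 𝓝[>] (0 : ℝ), E.map^[k] x + t ∉ Ico c d := by
        rw [mem_Ico, not_and_or, not_le, not_lt] at hk'
        rcases hk' with h | h
        · filter_upwards [Ioo_mem_nhdsGT (sub_pos.2 h)] with t ht hmem
          linarith [hmem.1, ht.2]
        · filter_upwards [self_mem_nhdsWithin] with t ht hmem
          linarith [hmem.2, mem_Ioi.1 ht]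
      filter_upwards [E.eventually_iterate_add hx k, h2] with t h3 h4
      rwa [h3]
    filter_upwards [h1, Ioo_mem_nhdsGT (sub_pos.2 hx.2)] with t ht1 ht2
    refine ⟨fun h => ?_, by linarith [hx.1, ht2.1], by linarith [ht2.2]⟩
    obtain ⟨k, hk, hkx⟩ := (hVmem _).1 h
    exact ht1 k (by simpa [Nat.lt_succ_iff] using hk) hkx
  obtain ⟨ε, hε, hsub⟩ := mem_nhdsGT_iff_exists_Ioo_subset.1 hev
  have : Ioo x (x + ε) ⊆ Vᶜ ∩ Ico (0 : ℝ) 1 := by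
    intro y hy
    have : y - x ∈ Ioo 0 ε := ⟨by linarith [hy.1], by linarith [hy.2]⟩
    simpa using hsub this
  have h0 := measure_mono_null this hnull
  rw [Real.volume_Ioo] at h0
  simp at h0
  exact absurd (mem_Ioi.1 hε) (not_lt.2 h0)

variable {E} in
/-- Every point lies on the forward orbit of a point of `[c, d)`. -/
lemma UniquelyErgodic.exists_iterate_eq_of_mem_Ico (hE : E.UniquelyErgodic) {c d : ℝ}
    (hc : 0 ≤ c) (hcd : c < d) (hd : d ≤ 1) {x : ℝ} (hx : x ∈ Ico (0 : ℝ) 1) :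
    ∃ k, ∃ y ∈ Ico c d, E.map^[k] y = x := by
  obtain ⟨R, hR⟩ := hE.exists_bounded_visit hc hcd hd
  obtain ⟨z, hz, rfl⟩ := E.exists_iterate_eq hx R
  obtain ⟨k, hk, hkz⟩ := hR z hz
  refine ⟨R - k, _, hkz, ?_⟩
  rw [← Function.iterate_add_apply, Nat.sub_add_cancel hk]

variable {E} in
/-- There are no periodic points, as a finite orbit misses some interval. -/
lemma UniquelyErgodic.iterate_ne_self (hE : E.UniquelyErgodic) {x : ℝ}
    (hx : x ∈ Ico (0 : ℝ) 1) {h : ℕ} (hh : 0 < h) : E.map^[h] x ≠ x := by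
  intro hper
  have hfin : (range fun k => E.map^[k] x).Finite := by
    refine ((Finset.range h).image fun k => E.map^[k] x).finite_toSet.subset ?_
    rintro _ ⟨k, rfl⟩
    simp only [Finset.coe_image, Finset.coe_range, mem_image, mem_Iio]
    exact ⟨k % h, Nat.mod_lt _ hh, (Function.IsPeriodicPt.iterate_mod_apply (f := E.map) hper k)⟩
  have hopen : IsOpen (Ioo (0 : ℝ) 1 \ range fun k => E.map^[k] x) :=
    isOpen_Ioo.sdiff hfin.isClosed
  obtain ⟨c, hc⟩ : (Ioo (0 : ℝ) 1 \ range fun k => E.map^[k] x).Nonempty :=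
    ((Ioo_infinite one_pos).sdiff hfin).nonempty
  obtain ⟨d, hcd, hsub⟩ := exists_Ico_subset_of_mem_nhds (hopen.mem_nhds hc) ⟨1, hc.1.2⟩
  have hd : d ≤ 1 := le_of_forall_lt fun z hz => by
    have := (hsub ⟨le_max_left c z, max_lt hcd hz⟩).1.2
    exact (le_max_right _ _).trans_lt this
  obtain ⟨R, hR⟩ := hE.exists_bounded_visit hc.1.1.le hcd hd
  obtain ⟨k, -, hk⟩ := hR x hx
  exact (hsub hk).2 ⟨k, rfl⟩

variable {E} in
/-- Without periodic points, a bounded number of steps displaces all points by at least some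
fixed distance, because only finitely many displacements occur. -/
lemma UniquelyErgodic.exists_displacement_bound (hE : E.UniquelyErgodic) (H : ℕ) :
    ∃ δ > 0, ∀ x ∈ Ico (0 : ℝ) 1, ∀ m, 0 < m → m ≤ H → δ ≤ |E.map^[m] x - x| := by
  have hfin : ∀ m, ∃ T : Set ℝ, T.Finite ∧ ∀ x ∈ Ico (0 : ℝ) 1, E.map^[m] x - x ∈ T := by
    intro m
    induction m with
    | zero => exact ⟨{0}, finite_singleton 0, by simp⟩
    | succ m ih =>
      obtain ⟨T, hT, hmem⟩ := ih
      refine ⟨image2 (· + ·) T (range E.translation), hT.image2 _ (finite_range _), ?_⟩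
      intro x hx
      obtain ⟨i, hi⟩ := E.exists_mem_atom (iterate_mem hx m)
      refine ⟨_, hmem x hx, _, ⟨i, rfl⟩, ?_⟩
      rw [Function.iterate_succ_apply', map_of_mem_atom hi]
      ring
  choose T hT hmem using hfin
  set D : Set ℝ := (⋃ m ∈ Finset.range (H + 1), T m) \ {0} with hD
  have hDfin : D.Finite :=
    (Set.Finite.biUnion (Finset.finite_toSet _) fun m _ => hT m).subset sdiff_subset
  have hopen : Dᶜ ∈ 𝓝 (0 : ℝ) := hDfin.isClosed.isOpen_compl.mem_nhds (by simp [hD])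
  obtain ⟨δ, hδ, hball⟩ := Metric.mem_nhds_iff.1 hopen
  refine ⟨δ, hδ, fun x hx m h0 hm => ?_⟩
  by_contra hlt
  rw [not_le] at hlt
  refine hball (a := E.map^[m] x - x) (by simpa using hlt) ⟨?_, ?_⟩
  · exact mem_biUnion (by simpa [Nat.lt_succ_iff] using hm) (hmem m x hx)
  · exact sub_ne_zero.2 (hE.iterate_ne_self hx h0)

end IET

/-! ### Words and incidence matrices -/

lemma List.sum_map_eq_sum_count {α : Type*} [Fintype α] [DecidableEq α] (u : List α) (f : α → ℝ) :
    (u.map f).sum = ∑ j, (u.count j : ℝ) * f j := by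
  induction u with
  | nil => simp
  | cons i u ih =>
    simp only [List.map_cons, List.sum_cons, ih, List.count_cons, Nat.cast_add, add_mul,
      Finset.sum_add_distrib]
    rw [add_comm]
    simp

/-- The iterates of a substitution on single letters. -/
def iterWord {N : ℕ} (σ : Fin N → List (Fin N)) : ℕ → Fin N → List (Fin N)
  | 0, i => [i]
  | k + 1, i => (iterWord σ k i).flatMap σ

lemma count_flatMap_eq_sum {N : ℕ} (σ : Fin N → List (Fin N)) (u : List (Fin N)) (j : Fin N) :
    ((u.flatMap σ).count j : ℤ) = ∑ i, incidenceMatrix σ j i * (u.count i : ℤ) := by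
  induction u with
  | nil => simp
  | cons i u ih =>
    simp only [List.flatMap_cons, List.count_append, Nat.cast_add, ih, List.count_cons,
      mul_add, Finset.sum_add_distrib]
    rw [add_comm]
    simp [incidenceMatrix]

/-- The powers of the incidence matrix count the letters of the iterated substitution. -/
lemma incidenceMatrix_pow {N : ℕ} (σ : Fin N → List (Fin N)) (k : ℕ) (j i : Fin N) :
    (incidenceMatrix σ ^ k) j i = ((iterWord σ k i).count j : ℤ) := by
  induction k generalizing j with
  | zero =>
    rw [pow_zero, Matrix.one_apply, iterWord, List.count_singleton]
    by_cases hij : j = i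
    · simp [hij]
    · simp [hij, Ne.symm hij]
  | succ k ih =>
    rw [pow_succ', Matrix.mul_apply, iterWord, count_flatMap_eq_sum]
    simp only [ih]

namespace IET

variable {N : ℕ} (E : IET N)

open MeasureTheory Set Filter Topology

/-- The orbit of `y` visits the intervals of the partition in the order given by the word `u`. -/
def FollowsWord (u : List (Fin N)) (y : ℝ) : Prop :=
  ∀ (k : ℕ) (hk : k < u.length), E.map^[k] y ∈ E.atom u[k]

variable {E}

lemma followsWord_cons {i : Fin N} {u : List (Fin N)} {y : ℝ} :
    E.FollowsWord (i :: u) y ↔ y ∈ E.atom i ∧ E.FollowsWord u (E.map y) := by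
  constructor
  · intro h
    refine ⟨h 0 (by simp), fun k hk => ?_⟩
    have := h (k + 1) (by simpa using hk)
    simpa using this
  · rintro ⟨h0, h⟩ k hk
    cases k with
    | zero => exact h0
    | succ k => simpa using h k (by simpa using hk)

lemma followsWord_append {u v : List (Fin N)} {y : ℝ} (hu : E.FollowsWord u y)
    (hv : E.FollowsWord v (E.map^[u.length] y)) : E.FollowsWord (u ++ v) y := by
  induction u generalizing y with
  | nil => exact hv
  | cons i u ih =>
    rw [followsWord_cons] at hu
    exact followsWord_cons.2 ⟨hu.1, ih hu.2 (by simpa using hv)⟩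

lemma FollowsWord.iterate_eq {u : List (Fin N)} {y : ℝ} (h : E.FollowsWord u y) :
    E.map^[u.length] y = y + (u.map E.translation).sum := by
  induction u generalizing y with
  | nil => simp
  | cons i u ih =>
    rw [followsWord_cons] at h
    rw [List.length_cons, Function.iterate_succ_apply, ih h.2, map_of_mem_atom h.1, List.map_cons,
      List.sum_cons, add_assoc]

lemma FollowsWord.take {u : List (Fin N)} {y : ℝ} (h : E.FollowsWord u y) (m : ℕ) :
    E.FollowsWord (u.take m) y := fun k hk => by
  rw [List.length_take, lt_min_iff] at hk
  simpa using h k hk.2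

namespace IsRenormalization

variable {ρ a : ℝ} {σ : Fin N → List (Fin N)} (h : E.IsRenormalization ρ a σ)
include h

lemma rescale_mem {x : ℝ} (hx : x ∈ Ico (0 : ℝ) 1) : a + ρ * x ∈ Ico a (a + ρ) := by
  have := h.ratio_pos
  exact ⟨by nlinarith [hx.1], by nlinarith [hx.2]⟩

lemma Ico_subset : Ico a (a + ρ) ⊆ Ico 0 1 := Ico_subset_Ico h.left_nonneg h.right_le_one

lemma length_word_pos (i : Fin N) : 0 < (σ i).length :=
  (h.firstReturn i _ (E.left_mem_atom i)).1

/-! ### The translations and the lengths as eigenvectors -/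

/-- The first return map translates the rescaled `i`-th interval by `ρ τ_i`, and also by the sum of
the translations along the word `σ i`. -/
lemma ratio_mul_translation (i : Fin N) :
    ρ * E.translation i = ∑ j, (incidenceMatrix σ j i : ℝ) * E.translation j := by
  have hx := E.left_mem_atom i
  have h1 := h.conj i _ hx
  have h2 : E.FollowsWord (σ i) (a + ρ * E.left i) := h.coding i _ hx
  rw [h2.iterate_eq, map_of_mem_atom hx, List.sum_map_eq_sum_count] at h1
  simp only [incidenceMatrix, Matrix.of_apply, Int.cast_natCast]
  linarith

/-- Before it returns, the rescaled `i`-th interval is moved rigidly. -/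
lemma iterate_rescale {i : Fin N} {x : ℝ} (hx : x ∈ E.atom i) {k : ℕ} (hk : k < (σ i).length) :
    E.map^[k] (a + ρ * x) = E.map^[k] (a + ρ * E.left i) + ρ * (x - E.left i) := by
  have h1 : E.FollowsWord (σ i) (a + ρ * x) := h.coding i _ hx
  have h2 : E.FollowsWord (σ i) (a + ρ * E.left i) := h.coding i _ (E.left_mem_atom i)
  have e1 := (h1.take k).iterate_eq
  have e2 := (h2.take k).iterate_eq
  rw [List.length_take, min_eq_left hk.le] at e1 e2
  rw [e1, e2]
  ring

/-- The floor at height `k` of the tower over the rescaled `i`-th interval is an interval of length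
`ρ |Ω_i|`. -/
lemma image_rescale_atom (i : Fin N) {k : ℕ} (hk : k < (σ i).length) :
    (fun x => E.map^[k] (a + ρ * x)) '' E.atom i =
      Ico (E.map^[k] (a + ρ * E.left i)) (E.map^[k] (a + ρ * E.left i) + ρ * E.length i) := by
  have hρ := h.ratio_pos
  ext y
  constructor
  · rintro ⟨x, hx, rfl⟩
    have hx' := hx
    simp only [atom, mem_Ico] at hx'
    simp only [h.iterate_rescale hx hk, mem_Ico]
    constructor
    · nlinarith
    · nlinarith
  · intro hy
    have hx : E.left i + (y - E.map^[k] (a + ρ * E.left i)) / ρ ∈ E.atom i := by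
      refine ⟨?_, ?_⟩
      · have := div_nonneg (sub_nonneg.2 hy.1) hρ.le
        linarith
      · have : (y - E.map^[k] (a + ρ * E.left i)) / ρ < E.length i := by
          rw [div_lt_iff₀ hρ]; linarith [hy.2]
        linarith
    refine ⟨_, hx, ?_⟩
    simp only [h.iterate_rescale hx hk]
    field_simp
    ring

/-- By minimality the floors cover the unit interval. -/
lemma exists_mem_floor (hE : E.UniquelyErgodic) {x : ℝ} (hx : x ∈ Ico (0 : ℝ) 1) :
    ∃ i, ∃ k < (σ i).length, ∃ y ∈ E.atom i, E.map^[k] (a + ρ * y) = x := by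
  classical
  have hρ := h.ratio_pos
  have hex := hE.exists_iterate_eq_of_mem_Ico (c := a) (d := a + ρ) h.left_nonneg
    (by linarith) h.right_le_one hx
  obtain ⟨y, hy, hyx⟩ := Nat.find_spec hex
  have hz : (y - a) / ρ ∈ Ico (0 : ℝ) 1 :=
    ⟨div_nonneg (sub_nonneg.2 hy.1) hρ.le, by rw [div_lt_iff₀ hρ]; linarith [hy.2]⟩
  have hay : a + ρ * ((y - a) / ρ) = y := by field_simp; ring
  obtain ⟨i, hi⟩ := E.exists_mem_atom hz
  refine ⟨i, Nat.find hex, ?_, _, hi, by rw [hay, hyx]⟩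
  -- Otherwise the return of `y` would be a later visit to the interval on the way to `x`.
  by_contra hle
  rw [not_lt] at hle
  have hret := (h.firstReturn i _ hi).2.1
  rw [hay] at hret
  have hpos := h.length_word_pos i
  refine Nat.find_min hex (m := Nat.find hex - (σ i).length) (by omega) ⟨_, hret, ?_⟩
  rw [← Function.iterate_add_apply, Nat.sub_add_cancel hle, hyx]

/-- The floors are pairwise disjoint, since the towers stop at the first return. -/
lemma eq_of_floor_eq {i j : Fin N} {k m : ℕ} (hk : k < (σ i).length)
    (hm : m < (σ j).length) {x y : ℝ} (hx : x ∈ E.atom i) (hy : y ∈ E.atom j)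
    (hxy : E.map^[k] (a + ρ * x) = E.map^[m] (a + ρ * y)) : i = j ∧ k = m := by
  have hρ := h.ratio_pos
  have aux : ∀ {i j : Fin N} {k m : ℕ}, k ≤ m → m < (σ j).length →
      ∀ {x y : ℝ}, x ∈ E.atom i → y ∈ E.atom j →
      E.map^[k] (a + ρ * x) = E.map^[m] (a + ρ * y) → i = j ∧ k = m := by
    intro i j k m hkm hm x y hx hy hxy
    have hxI := h.rescale_mem (E.atom_subset i hx)
    have hyI := h.rescale_mem (E.atom_subset j hy)
    obtain ⟨n, rfl⟩ := Nat.exists_eq_add_of_le hkm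
    rw [Function.iterate_add_apply] at hxy
    have heq := iterate_inj (h.Ico_subset hxI) (iterate_mem (h.Ico_subset hyI) n) k hxy
    rcases Nat.eq_zero_or_pos n with rfl | hn
    · have : x = y := by
        have : ρ * x = ρ * y := by simpa using heq
        exact mul_left_cancel₀ hρ.ne' this
      subst this
      exact ⟨eq_of_mem_atom hx hy, by simp⟩
    · exact absurd (heq ▸ hxI) ((h.firstReturn j _ hy).2.2 n hn (by omega))
  rcases le_total k m with hkm | hkm
  · exact aux hkm hm hx hy hxy
  · obtain ⟨h1, h2⟩ := aux hkm hk hy hx hxy.symm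
    exact ⟨h1.symm, h2.symm⟩

/-- The floors of the towers partition the unit interval, and each of them lies in one interval of
the partition; comparing the lengths gives the eigenvector equation. -/
lemma length_eq_sum (hE : E.UniquelyErgodic) (j : Fin N) :
    E.length j = ρ * ∑ i, (incidenceMatrix σ j i : ℝ) * E.length i := by
  have hρ := h.ratio_pos
  set F : (Σ i, Fin (σ i).length) → Set ℝ := fun p =>
    (fun x => E.map^[(p.2 : ℕ)] (a + ρ * x)) '' E.atom p.1 with hF
  have hFIco : ∀ p, F p = Ico (E.map^[(p.2 : ℕ)] (a + ρ * E.left p.1))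
      (E.map^[(p.2 : ℕ)] (a + ρ * E.left p.1) + ρ * E.length p.1) := fun p =>
    h.image_rescale_atom p.1 p.2.2
  set S : Finset (Σ i, Fin (σ i).length) :=
    Finset.univ.filter fun p => (σ p.1)[(p.2 : ℕ)] = j with hS
  have hcover : E.atom j = ⋃ p ∈ S, F p := by
    ext x
    simp only [mem_iUnion, hS, Finset.mem_filter, Finset.mem_univ, true_and]
    constructor
    · intro hx
      obtain ⟨i, k, hk, y, hy, rfl⟩ := h.exists_mem_floor hE (E.atom_subset j hx)
      exact ⟨⟨i, k, hk⟩, eq_of_mem_atom (h.coding i y hy k hk) hx, y, hy, rfl⟩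
    · rintro ⟨⟨i, k⟩, hj, y, hy, rfl⟩
      exact hj ▸ h.coding i y hy k k.2
  have hvol : volume (E.atom j) = ∑ p ∈ S, volume (F p) := by
    rw [hcover, measure_biUnion_finset]
    · rintro ⟨i, k⟩ _ ⟨i', k'⟩ _ hne
      refine Set.disjoint_left.2 ?_
      rintro _ ⟨x, hx, rfl⟩ ⟨y, hy, hxy⟩
      obtain ⟨rfl, hkk⟩ := h.eq_of_floor_eq k.2 k'.2 hx hy hxy.symm
      exact hne (by rw [Fin.ext hkk])
    · intro p _
      rw [hFIco]; exact measurableSet_Ico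
  simp only [hFIco, atom, Real.volume_Ico, add_sub_cancel_left] at hvol
  rw [← ENNReal.ofReal_sum_of_nonneg fun p _ => (mul_pos hρ (E.length_pos p.1)).le,
    ENNReal.ofReal_eq_ofReal_iff (E.length_pos j).le
      (Finset.sum_nonneg fun p _ => (mul_pos hρ (E.length_pos p.1)).le)] at hvol
  rw [hvol, hS, Finset.sum_filter, Fintype.sum_sigma, Finset.mul_sum]
  refine Finset.sum_congr rfl fun i _ => ?_
  have hcount : (Finset.univ.filter fun k : Fin (σ i).length => (σ i)[(k : ℕ)] = j).card =
      (σ i).count j := by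
    have := Fin.card_filter_univ_eq_vector_get_eq_count j ⟨σ i, rfl⟩
    rw [List.Vector.toList_mk] at this
    rw [← this]
    congr 1
  have hsum : (∑ k : Fin (σ i).length, if (σ i)[(k : ℕ)] = j then ρ * E.length i else 0) =
      ρ * ((incidenceMatrix σ j i : ℝ) * E.length i) := by
    rw [← Finset.sum_filter, Finset.sum_const, nsmul_eq_mul, hcount]
    simp only [incidenceMatrix, Matrix.of_apply, Int.cast_natCast]
    ring
  exact hsum

/-! ### Primitivity -/

/-- Rescaling a point applies the substitution to its itinerary. -/
lemma iterate_flatMap {u : List (Fin N)} {y : ℝ} (hu : E.FollowsWord u y) :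
    E.FollowsWord (u.flatMap σ) (a + ρ * y) ∧
      E.map^[(u.flatMap σ).length] (a + ρ * y) = a + ρ * E.map^[u.length] y := by
  induction u generalizing y with
  | nil => exact ⟨fun k hk => absurd hk (by simp), by simp⟩
  | cons i u ih =>
    rw [followsWord_cons] at hu
    obtain ⟨h1, h2⟩ := ih hu.2
    have hc := h.conj i y hu.1
    rw [List.flatMap_cons]
    refine ⟨followsWord_append (h.coding i y hu.1) (by rwa [hc]), ?_⟩
    rw [List.length_append, add_comm, Function.iterate_add_apply, hc, h2]
    simp

/-- The `k`-th power of the renormalization is coded by the `k`-th power of the substitution. -/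
lemma iterate_iterWord (k : ℕ) {i : Fin N} {x : ℝ} (hx : x ∈ E.atom i) :
    E.FollowsWord (iterWord σ k i) ((fun z => a + ρ * z)^[k] x) ∧
      E.map^[(iterWord σ k i).length] ((fun z => a + ρ * z)^[k] x) =
        (fun z => a + ρ * z)^[k] (E.map x) := by
  induction k with
  | zero => exact ⟨followsWord_cons.2 ⟨hx, fun m hm => absurd hm (by simp)⟩, rfl⟩
  | succ k ih =>
    rw [Function.iterate_succ_apply', Function.iterate_succ_apply', iterWord]
    obtain ⟨h1, h2⟩ := h.iterate_flatMap ih.1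
    exact ⟨h1, by rw [h2, ih.2]⟩

lemma rescale_iterate_mem (k : ℕ) {x : ℝ} (hx : x ∈ Ico (0 : ℝ) 1) :
    (fun z => a + ρ * z)^[k] x ∈ Ico (0 : ℝ) 1 := by
  induction k with
  | zero => exact hx
  | succ k ih =>
    rw [Function.iterate_succ_apply']
    exact h.Ico_subset (h.rescale_mem ih)

omit h in
lemma rescale_iterate_sub (k : ℕ) (x y : ℝ) :
    (fun z => a + ρ * z)^[k] x - (fun z => a + ρ * z)^[k] y = ρ ^ k * (x - y) := by
  induction k with
  | zero => simp
  | succ k ih =>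
    rw [Function.iterate_succ_apply', Function.iterate_succ_apply', pow_succ']
    linear_combination ρ * ih

lemma length_iterWord_pos (k : ℕ) (i : Fin N) : 0 < (iterWord σ k i).length := by
  induction k with
  | zero => simp [iterWord]
  | succ k ih =>
    obtain ⟨j, hj⟩ := List.exists_mem_of_length_pos ih
    obtain ⟨l, hl⟩ := List.exists_mem_of_length_pos (h.length_word_pos j)
    exact List.length_pos_of_mem (List.mem_flatMap.2 ⟨j, hj, hl⟩)

/-- The return times to the renormalized intervals tend to infinity: the interval of level `k` has
length `ρ ^ k`, and points return to it. -/
lemma exists_lt_length_iterWord (hE : E.UniquelyErgodic) (H : ℕ) :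
    ∃ k > 0, ∀ i, H < (iterWord σ k i).length := by
  obtain ⟨δ, hδ, hdisp⟩ := hE.exists_displacement_bound H
  obtain ⟨n, hn⟩ := exists_pow_lt_of_lt_one hδ h.ratio_lt_one
  refine ⟨n + 1, Nat.succ_pos n, fun i => ?_⟩
  by_contra hle
  rw [not_lt] at hle
  have hx := E.left_mem_atom i
  have hx01 := E.atom_subset i hx
  have hmx := map_mem (E := E) hx01
  have h1 := hdisp _ (h.rescale_iterate_mem (n + 1) hx01) _ (h.length_iterWord_pos (n + 1) i) hle
  have hρ := pow_pos h.ratio_pos (n + 1)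
  have habs : |E.map (E.left i) - E.left i| ≤ 1 := by
    rw [abs_le]; constructor <;> linarith [hx01.1, hx01.2, hmx.1, hmx.2]
  rw [(h.iterate_iterWord (n + 1) hx).2, rescale_iterate_sub, abs_mul, abs_of_pos hρ] at h1
  have h2 : ρ ^ (n + 1) ≤ ρ ^ n :=
    pow_le_pow_of_le_one h.ratio_pos.le h.ratio_lt_one.le (Nat.le_succ n)
  nlinarith

/-- A level whose towers are higher than the bounded visiting times of all intervals of the
partition gives a positive power of the incidence matrix. -/
theorem isPrimitive (hE : E.UniquelyErgodic) : (incidenceMatrix σ).IsPrimitive := by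
  refine ⟨fun i j => by simp [incidenceMatrix], ?_⟩
  have hvisit : ∀ j, ∃ R, ∀ x ∈ Ico (0 : ℝ) 1, ∃ k ≤ R, E.map^[k] x ∈ E.atom j := fun j =>
    hE.exists_bounded_visit (E.orderedLeft_nonneg 1 j)
      (lt_add_of_pos_right _ (E.length_pos j)) (E.orderedLeft_add_length_le_one 1 j)
  choose R hR using hvisit
  obtain ⟨k, hk, hlen⟩ := h.exists_lt_length_iterWord hE (Finset.univ.sup R)
  refine ⟨k, hk, fun j i => ?_⟩
  have hx := E.left_mem_atom i
  obtain ⟨m, hm, hmj⟩ := hR j _ (h.rescale_iterate_mem k (E.atom_subset i hx))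
  have hmlt : m < (iterWord σ k i).length :=
    (hm.trans (Finset.le_sup (Finset.mem_univ j))).trans_lt (hlen i)
  have := eq_of_mem_atom ((h.iterate_iterWord k hx).1 m hmlt) hmj
  rw [incidenceMatrix_pow]
  exact_mod_cast List.count_pos_iff.2 (this ▸ List.getElem_mem hmlt)

end IsRenormalization

end IET

/-! ### Perron–Frobenius theory for a primitive integer matrix with a positive eigenvector -/

lemma Matrix.pow_sum_eq {N : ℕ} {R : Type*} [CommRing R] (M : Matrix (Fin N) (Fin N) ℤ)
    {v : Fin N → R} {μ : R} (hv : ∀ i, ∑ j, (M i j : R) * v j = μ * v i) (k : ℕ) (i : Fin N) :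
    ∑ j, ((M ^ k) i j : R) * v j = μ ^ k * v i := by
  induction k generalizing i with
  | zero => simp [Matrix.one_apply]
  | succ k ih =>
    simp only [pow_succ', Matrix.mul_apply, Int.cast_sum, Int.cast_mul, Finset.sum_mul]
    rw [Finset.sum_comm]
    simp only [mul_assoc, ← Finset.mul_sum, ih]
    calc ∑ j, (M i j : R) * (μ ^ k * v j) = μ ^ k * ∑ j, (M i j : R) * v j := by
          rw [Finset.mul_sum]
          exact Finset.sum_congr rfl fun j _ => by ring
      _ = μ * μ ^ k * v i := by rw [hv i]; ring
      _ = μ * (μ ^ k * v i) := mul_assoc _ _ _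

/-- An eigenvector whose eigenvalue is not smaller in modulus than that of the positive eigenvector
`l` is a multiple of `l`, by the equality case of the triangle inequality in the row where
`‖v i‖ / l i` is largest. -/
lemma Matrix.IsPrimitive.norm_lt_or_eq_smul {N : ℕ} {M : Matrix (Fin N) (Fin N) ℤ}
    (hM : M.IsPrimitive) {l : Fin N → ℝ} (hl : ∀ i, 0 < l i) {β : ℝ} (hβ : 0 < β)
    (hMl : ∀ i, ∑ j, (M i j : ℝ) * l j = β * l i) {v : Fin N → ℂ} {μ : ℂ} (hv : v ≠ 0)
    (hMv : ∀ i, ∑ j, (M i j : ℂ) * v j = μ * v i) :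
    ‖μ‖ < β ∨ ∃ c : ℂ, ∀ i, v i = c * l i := by
  refine or_iff_not_imp_left.2 fun hμ => ?_
  rw [not_lt] at hμ
  obtain ⟨k, -, hpos⟩ := hM.exists_pos_pow
  obtain ⟨j₀, hj₀⟩ := Function.ne_iff.1 hv
  obtain ⟨i, -, hi⟩ := Finset.univ.exists_max_image (fun i => ‖v i‖ / l i) ⟨j₀, Finset.mem_univ _⟩
  set c := ‖v i‖ / l i with hc
  have hc0 : 0 < c :=
    (div_pos (norm_pos_iff.2 hj₀) (hl j₀)).trans_le (hi j₀ (Finset.mem_univ _))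
  have hvc : ∀ j, ‖v j‖ ≤ c * l j := fun j => (div_le_iff₀ (hl j)).1 (hi j (Finset.mem_univ _))
  have hvi : ‖v i‖ = c * l i := by rw [hc, div_mul_cancel₀ _ (hl i).ne']
  have hzl : ∑ j, ((M ^ k) i j : ℝ) * (c * l j) = c * (β ^ k * l i) := by
    rw [← M.pow_sum_eq hMl k i, Finset.mul_sum]
    exact Finset.sum_congr rfl fun j _ => by ring
  set z := ∑ j, ((M ^ k) i j : ℂ) * v j with hz
  have hznorm : c * (β ^ k * l i) ≤ ‖z‖ := by
    rw [hz, M.pow_sum_eq hMv k i, norm_mul, norm_pow, hvi]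
    have := pow_le_pow_left₀ hβ.le hμ k
    have h2 := mul_le_mul_of_nonneg_right this (mul_pos hc0 (hl i)).le
    linarith
  have hz0 : 0 < ‖z‖ := lt_of_lt_of_le (mul_pos hc0 (mul_pos (pow_pos hβ k) (hl i))) hznorm
  have hzne : z ≠ 0 := norm_pos_iff.1 hz0
  -- Rotate so that `z` becomes a positive real number.
  set u : ℂ := ‖z‖ / z with hu
  have hunorm : ‖u‖ = 1 := by rw [hu, norm_div, Complex.norm_real, norm_norm, div_self hz0.ne']
  have huz : u * z = ‖z‖ := div_mul_cancel₀ _ hzne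
  have hre : ∑ j, ((M ^ k) i j : ℝ) * (u * v j).re = ‖z‖ := by
    have h1 : (u * z).re = ‖z‖ := by rw [huz, Complex.ofReal_re]
    rw [← h1, hz, Finset.mul_sum, Complex.re_sum]
    refine Finset.sum_congr rfl fun j _ => ?_
    rw [mul_left_comm, ← Complex.ofReal_intCast, Complex.re_ofReal_mul]
  have hle : ∀ j, (u * v j).re ≤ c * l j := fun j =>
    (Complex.re_le_norm _).trans (by rw [norm_mul, hunorm, one_mul]; exact hvc j)
  have hP : ∀ j, (0 : ℝ) < ((M ^ k) i j : ℝ) := fun j => by exact_mod_cast hpos i j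
  have heq : ∀ j, (u * v j).re = c * l j := by
    have hsum : ∑ j, ((M ^ k) i j : ℝ) * (u * v j).re = ∑ j, ((M ^ k) i j : ℝ) * (c * l j) :=
      le_antisymm (Finset.sum_le_sum fun j _ => mul_le_mul_of_nonneg_left (hle j) (hP j).le)
        (by rw [hzl, hre]; exact hznorm)
    intro j
    have := (Finset.sum_eq_sum_iff_of_le fun j _ =>
      mul_le_mul_of_nonneg_left (hle j) (hP j).le).1 hsum j (Finset.mem_univ j)
    exact mul_left_cancel₀ (hP j).ne' this
  refine ⟨u⁻¹ * c, fun j => ?_⟩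
  have hnorm : (u * v j).re = ‖u * v j‖ :=
    le_antisymm (Complex.re_le_norm _) (by rw [heq, norm_mul, hunorm, one_mul]; exact hvc j)
  have huv : u * v j = ((c * l j : ℝ) : ℂ) := by
    have h0 := Complex.re_eq_norm.1 hnorm
    rw [Complex.nonneg_iff] at h0
    exact Complex.ext (by rw [heq, Complex.ofReal_re]) (by rw [← h0.2, Complex.ofReal_im])
  have hune : u ≠ 0 := norm_pos_iff.1 (by rw [hunorm]; exact one_pos)
  rw [mul_assoc, ← Complex.ofReal_mul, ← huv, inv_mul_cancel_left₀ hune]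

lemma Matrix.IsPrimitive.isLargestEigenvalue {N : ℕ} {M : Matrix (Fin N) (Fin N) ℤ}
    (hM : M.IsPrimitive) {l : Fin N → ℝ} (hl : ∀ i, 0 < l i) (hl0 : l ≠ 0) {β : ℝ} (hβ : 0 < β)
    (hMl : ∀ i, ∑ j, (M i j : ℝ) * l j = β * l i) : IsLargestEigenvalue M β := by
  refine ⟨Module.End.hasEigenvalue_of_hasEigenvector (x := l)
    ⟨Module.End.mem_eigenspace_iff.2 (funext fun i => ?_), hl0⟩, fun μ hμ hne => ?_⟩
  · simpa [Matrix.toLin'_apply, Matrix.mulVec, dotProduct] using hMl i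
  · obtain ⟨v, hv⟩ := hμ.exists_hasEigenvector
    have hMv : ∀ i, ∑ j, (M i j : ℂ) * v j = μ * v i := fun i => by
      have := congrFun hv.apply_eq_smul i
      simpa [Matrix.toLin'_apply, Matrix.mulVec, dotProduct] using this
    refine (hM.norm_lt_or_eq_smul hl hβ hMl hv.2 hMv).resolve_right ?_
    rintro ⟨c, hc⟩
    obtain ⟨i, hi⟩ := Function.ne_iff.1 hv.2
    have hMli : ∑ j, (M i j : ℂ) * (l j : ℂ) = β * l i := by exact_mod_cast hMl i
    refine hne (mul_right_cancel₀ hi ?_)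
    rw [← hMv i, hc i]
    calc ∑ j, (M i j : ℂ) * v j = c * ∑ j, (M i j : ℂ) * (l j : ℂ) := by
          rw [Finset.mul_sum]
          exact Finset.sum_congr rfl fun j _ => by rw [hc j]; ring
      _ = β * (c * l i) := by rw [hMli]; ring

/-- The eigenspace of the largest eigenvalue is a line. -/
lemma Matrix.IsPrimitive.eq_smul_of_eigenvector {N : ℕ} {M : Matrix (Fin N) (Fin N) ℤ}
    (hM : M.IsPrimitive) {l : Fin N → ℝ} (hl : ∀ i, 0 < l i) {β : ℝ} (hβ : 0 < β)
    (hMl : ∀ i, ∑ j, (M i j : ℝ) * l j = β * l i) {w : Fin N → ℝ} (hw : w ≠ 0)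
    (hMw : ∀ i, ∑ j, (M i j : ℝ) * w j = β * w i) : ∃ c : ℝ, ∀ i, w i = c * l i := by
  have hv : (fun i => (w i : ℂ)) ≠ 0 := fun h => hw (funext fun i => by
    simpa using congrFun h i)
  have hMv : ∀ i, ∑ j, (M i j : ℂ) * (w j : ℂ) = (β : ℂ) * (w i : ℂ) := fun i => by
    exact_mod_cast hMw i
  rcases hM.norm_lt_or_eq_smul hl hβ hMl hv hMv with h | ⟨c, hc⟩
  · rw [Complex.norm_real, Real.norm_of_nonneg hβ.le] at h
    exact absurd h (lt_irrefl _)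
  · exact ⟨c.re, fun i => by simpa using congrArg Complex.re (hc i)⟩

/-! ### The drift as an alternating form on the dual of the field -/

section Drift

open Module

variable {F K ι : Type*} [Field F] [Field K] [Algebra F K] [Fintype ι] (l t : ι → K)

/-- The drift of lengths `l` and translations `t` in a field `K` as a linear map on the dual of `K`:
a functional `f` is sent to `∑ i, f (t i) • l i`. The values on the dual of a basis of `K` are the
coordinates of the drift vector in this basis. -/
def driftMap (F : Type*) {K ι : Type*} [Field F] [Field K] [Algebra F K] [Fintype ι]
    (l t : ι → K) : Dual F K →ₗ[F] K := ∑ i, (Dual.eval F K (t i)).smulRight (l i)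

lemma driftMap_apply (f : Dual F K) : driftMap F l t f = ∑ i, f (t i) • l i := by
  simp [driftMap]

/-- The values of a functional on a family of elements of `K`. -/
def dualValues (F : Type*) {K ι : Type*} [Field F] [Field K] [Algebra F K] (l : ι → K) :
    Dual F K →ₗ[F] (ι → F) := LinearMap.pi fun i => Dual.eval F K (l i)

omit [Fintype ι] in
lemma dualValues_apply (f : Dual F K) (i : ι) : dualValues F l f i = f (l i) := rfl

variable {l t}

omit [Fintype ι] in
lemma dualValues_injective (hl : Submodule.span F (Set.range l) = ⊤) :
    Function.Injective (dualValues F l) := by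
  intro f g hfg
  refine LinearMap.ext_on_range hl fun i => ?_
  exact congrFun hfg i

/-- If multiplication by `r` and its inverse act on `t` and `l` through transposed matrices, then
the drift map intertwines multiplication by `r` on the dual with division by `r` on `K`. -/
lemma mul_driftMap_comp {r : K} {M : ι → ι → ℤ}
    (ht : ∀ i, r * t i = ∑ j, (M j i : K) * t j) (hl : ∀ j, l j = r * ∑ i, (M j i : K) * l i)
    (f : Dual F K) : r * driftMap F l t (f ∘ₗ LinearMap.mulLeft F r) = driftMap F l t f := by
  have hf : ∀ i, f (r * t i) = ∑ j, (M j i : F) * f (t j) := fun i => by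
    rw [ht, map_sum]
    refine Finset.sum_congr rfl fun j _ => ?_
    rw [← zsmul_eq_mul, map_zsmul, zsmul_eq_mul]
  simp only [driftMap_apply, LinearMap.comp_apply, LinearMap.mulLeft_apply, hf, Finset.sum_smul]
  rw [Finset.sum_comm, Finset.mul_sum]
  refine Finset.sum_congr rfl fun j _ => ?_
  conv_rhs => rw [hl j]
  rw [← mul_smul_comm, Finset.smul_sum]
  congr 1
  refine Finset.sum_congr rfl fun i _ => ?_
  simp only [Algebra.smul_def, map_mul, map_intCast]
  ring

/-- The dual of `K` is one-dimensional over `K = F(r)`, and the kernel of the drift map is a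
`K`-subspace of it. -/
lemma driftMap_injective_or_eq_zero [FiniteDimensional F K] {r : K} (hr0 : r ≠ 0)
    (hr : Algebra.adjoin F {r} = ⊤)
    {M : ι → ι → ℤ} (ht : ∀ i, r * t i = ∑ j, (M j i : K) * t j)
    (hl : ∀ j, l j = r * ∑ i, (M j i : K) * l i) :
    Function.Injective (driftMap F l t) ∨ driftMap F l t = 0 := by
  refine or_iff_not_imp_left.2 fun hinj => ?_
  rw [injective_iff_map_eq_zero] at hinj
  push Not at hinj
  obtain ⟨f, hf, hf0⟩ := hinj
  have hker : ∀ y : K, ∀ g, driftMap F l t g = 0 →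
      driftMap F l t (g ∘ₗ LinearMap.mulLeft F y) = 0 := by
    intro y
    have hy : y ∈ Algebra.adjoin F {r} := by rw [hr]; trivial
    induction hy using Algebra.adjoin_induction with
    | mem x hx =>
      rw [Set.mem_singleton_iff] at hx
      subst hx
      intro g hg
      have := mul_driftMap_comp ht hl g
      rw [hg] at this
      exact (mul_eq_zero.1 this).resolve_left hr0
    | algebraMap q =>
      intro g hg
      have : g ∘ₗ LinearMap.mulLeft F (algebraMap F K q) = q • g := by
        ext x
        simp only [LinearMap.comp_apply, LinearMap.mulLeft_apply, LinearMap.smul_apply]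
        rw [← Algebra.smul_def, map_smul]
      rw [this, map_smul, hg, smul_zero]
    | add x y _ _ hx hy =>
      intro g hg
      have : g ∘ₗ LinearMap.mulLeft F (x + y) =
          g ∘ₗ LinearMap.mulLeft F x + g ∘ₗ LinearMap.mulLeft F y := by
        ext z
        simp [add_mul]
      rw [this, map_add, hx g hg, hy g hg, add_zero]
    | mul x y _ _ hx hy =>
      intro g hg
      have : g ∘ₗ LinearMap.mulLeft F (x * y) =
          (g ∘ₗ LinearMap.mulLeft F x) ∘ₗ LinearMap.mulLeft F y := by
        ext z
        simp
      rw [this]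
      exact hy _ (hx g hg)
  -- Every functional is `x ↦ f (y * x)` for some `y`.
  set Φ : K →ₗ[F] Dual F K := (LinearMap.mul F K).compr₂ f with hΦ
  have hΦinj : Function.Injective Φ := by
    rw [injective_iff_map_eq_zero]
    intro y hy
    by_contra hy0
    refine hf0 (LinearMap.ext fun x => ?_)
    have := LinearMap.congr_fun hy (y⁻¹ * x)
    simpa [hΦ, mul_inv_cancel_left₀ hy0] using this
  have hΦsurj : Function.Surjective Φ :=
    (LinearMap.injective_iff_surjective_of_finrank_eq_finrank
      (Subspace.dual_finrank_eq (K := F) (V := K)).symm).1 hΦinj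
  refine LinearMap.ext fun g => ?_
  obtain ⟨y, rfl⟩ := hΦsurj g
  exact hker y f hf

lemma apply_driftMap_comm {Ω : ι → ι → ℤ} (hΩ : ∀ i j, Ω j i = -Ω i j)
    (ht : ∀ i, t i = ∑ j, (Ω i j : K) * l j) (f g : Dual F K) :
    g (driftMap F l t f) = -f (driftMap F l t g) := by
  have key : ∀ f g : Dual F K, g (driftMap F l t f) =
      ∑ i, ∑ j, (Ω i j : F) * f (l j) * g (l i) := by
    intro f g
    rw [driftMap_apply, map_sum]
    refine Finset.sum_congr rfl fun i _ => ?_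
    rw [map_smul, smul_eq_mul, ht, map_sum, Finset.sum_mul]
    refine Finset.sum_congr rfl fun j _ => ?_
    rw [← zsmul_eq_mul, map_zsmul, zsmul_eq_mul]
  rw [key, key, Finset.sum_comm, ← Finset.sum_neg_distrib]
  refine Finset.sum_congr rfl fun i _ => ?_
  rw [← Finset.sum_neg_distrib]
  refine Finset.sum_congr rfl fun j _ => ?_
  rw [hΩ i j]
  push_cast
  ring

/-- A nondegenerate alternating form lives in even dimension. -/
lemma even_finrank_of_driftMap_injective [LinearOrder F] [IsStrictOrderedRing F]
    [FiniteDimensional F K] {Ω : ι → ι → ℤ}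
    (hΩ : ∀ i j, Ω j i = -Ω i j) (ht : ∀ i, t i = ∑ j, (Ω i j : K) * l j)
    (hinj : Function.Injective (driftMap F l t)) : Even (finrank F K) := by
  set b := finBasis F K
  set e := LinearEquiv.ofInjectiveOfFinrankEq (driftMap F l t) hinj Subspace.dual_finrank_eq with he
  set A := LinearMap.toMatrix b.dualBasis b (e : Dual F K →ₗ[F] K) with hA
  have hdet : A.det ≠ 0 := (LinearEquiv.isUnit_det e b.dualBasis b).ne_zero
  have hAt : A.transpose = -A := by
    ext i j
    simp only [hA, Matrix.transpose_apply, Matrix.neg_apply, LinearMap.toMatrix_apply,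
      ← Basis.dualBasis_apply]
    exact apply_driftMap_comm hΩ ht _ _
  by_contra hodd
  rw [Nat.not_even_iff_odd] at hodd
  have h1 := A.det_transpose
  rw [hAt, Matrix.det_neg, Fintype.card_fin, hodd.neg_one_pow] at h1
  exact hdet (by linarith)

/-- The values of functionals on `t` and on `l` are orthogonal spaces of dimension `dim K`. -/
lemma two_mul_finrank_le_of_driftMap_eq_zero [LinearOrder F] [IsStrictOrderedRing F]
    [FiniteDimensional F K]
    (hl : Submodule.span F (Set.range l) = ⊤) (ht : Submodule.span F (Set.range t) = ⊤)
    (h0 : driftMap F l t = 0) : 2 * finrank F K ≤ Fintype.card ι := by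
  have horth : ∀ f g, ∑ i, dualValues F t f i * dualValues F l g i = 0 := by
    intro f g
    have : g (driftMap F l t f) = 0 := by rw [h0]; simp
    rw [driftMap_apply, map_sum] at this
    simpa [dualValues_apply] using this
  -- Over an ordered field orthogonal spaces intersect trivially, so their sum is direct.
  have hinj : Function.Injective ((dualValues F t).coprod (dualValues F l)) := by
    rw [injective_iff_map_eq_zero]
    rintro ⟨f, g⟩ hfg
    rw [LinearMap.coprod_apply] at hfg
    have hneg : dualValues F l g = -dualValues F t f := (neg_eq_of_add_eq_zero_right hfg).symm
    have hsq : ∑ i, dualValues F t f i * dualValues F t f i = 0 := by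
      have := horth f g
      rw [hneg] at this
      simpa using this
    have hf : dualValues F t f = 0 := by
      funext i
      have := (Finset.sum_eq_zero_iff_of_nonneg fun i _ => mul_self_nonneg _).1 hsq i
        (Finset.mem_univ i)
      exact mul_self_eq_zero.1 this
    have hg : dualValues F l g = 0 := by rw [hneg, hf, neg_zero]
    rw [dualValues_injective ht (hf.trans (map_zero _).symm),
      dualValues_injective hl (hg.trans (map_zero _).symm)]
    rfl
  have := LinearMap.finrank_le_finrank_of_injective hinj
  rwa [finrank_prod, Subspace.dual_finrank_eq, ← two_mul, finrank_fintype_fun_eq_card] at this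

end Drift

/-! ### Number fields generated by the scaling ratio -/

/-- Multiplying the integral equation of `x` of degree `n` by `x⁻¹ ^ (n - 1)` expresses `x` by
powers of `x⁻¹`. -/
lemma IsIntegral.mem_adjoin_int_inv {x : ℝ} (hx : IsIntegral ℤ x) (hx0 : x ≠ 0) :
    x ∈ Algebra.adjoin ℤ {x⁻¹} := by
  obtain ⟨p, hp, hpx⟩ := hx
  have hn : p.natDegree ≠ 0 := by
    intro h0
    rw [hp.natDegree_eq_zero.1 h0] at hpx
    simp at hpx
  obtain ⟨n, hn⟩ := Nat.exists_eq_succ_of_ne_zero hn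
  rw [hp.as_sum, hn, Polynomial.eval₂_add, Polynomial.eval₂_X_pow,
    Polynomial.eval₂_finsetSum, Nat.succ_eq_add_one] at hpx
  have hmem : x⁻¹ ∈ Algebra.adjoin ℤ {x⁻¹} := Algebra.subset_adjoin rfl
  have hxe : x = -∑ i ∈ Finset.range (n + 1), (p.coeff i : ℝ) * x⁻¹ ^ (n - i) := by
    have h1 : x ^ (n + 1) * x⁻¹ ^ n = x := by
      rw [pow_succ', mul_assoc, ← mul_pow, mul_inv_cancel₀ hx0, one_pow, mul_one]
    have h2 : x = (-∑ i ∈ Finset.range (n + 1), Polynomial.eval₂ (algebraMap ℤ ℝ) x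
        (Polynomial.C (p.coeff i) * Polynomial.X ^ i)) * x⁻¹ ^ n := by
      rw [← eq_neg_of_add_eq_zero_left hpx, h1]
    refine h2.trans ?_
    rw [neg_mul, Finset.sum_mul]
    congr 1
    refine Finset.sum_congr rfl fun i hi => ?_
    have hin : n = i + (n - i) := by have := Finset.mem_range.1 hi; omega
    simp only [Polynomial.eval₂_mul, Polynomial.eval₂_C, Polynomial.eval₂_X_pow]
    conv_lhs => rw [hin, pow_add]
    rw [mul_assoc, ← mul_assoc (x ^ i), ← mul_pow, mul_inv_cancel₀ hx0, one_pow, one_mul]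
    rfl
  have hsum : -∑ i ∈ Finset.range (n + 1), (p.coeff i : ℝ) * x⁻¹ ^ (n - i) ∈
      Algebra.adjoin ℤ {x⁻¹} :=
    neg_mem (sum_mem fun i _ => mul_mem (intCast_mem _ _) (pow_mem hmem _))
  rwa [← hxe] at hsum

/-- A nonzero subspace of `K = F(r)` that is stable under multiplication by `r` is all of `K`. -/
lemma Submodule.eq_top_of_mul_mem {F K : Type*} [Field F] [Field K] [Algebra F K] {r : K}
    (hr : Algebra.adjoin F {r} = ⊤) (V : Submodule F K) {x : K} (hx : x ∈ V) (hx0 : x ≠ 0)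
    (hV : ∀ y ∈ V, r * y ∈ V) : V = ⊤ := by
  have key : ∀ z : K, ∀ y ∈ V, z * y ∈ V := by
    intro z
    have hz : z ∈ Algebra.adjoin F {r} := by rw [hr]; trivial
    induction hz using Algebra.adjoin_induction with
    | mem z hz => rw [Set.mem_singleton_iff.1 hz]; exact hV
    | algebraMap q => intro y hy; rw [← Algebra.smul_def]; exact V.smul_mem q hy
    | add z w _ _ hz hw => intro y hy; rw [add_mul]; exact V.add_mem (hz y hy) (hw y hy)
    | mul z w _ _ hz hw => intro y hy; rw [mul_assoc]; exact hz _ (hw y hy)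
  refine eq_top_iff.2 fun z _ => ?_
  have := key (z * x⁻¹) x hx
  rwa [inv_mul_cancel_right₀ hx0] at this

lemma IntermediateField.adjoin_gen_eq_top {r : ℝ} (hr : IsIntegral ℚ r) :
    Algebra.adjoin ℚ {IntermediateField.AdjoinSimple.gen ℚ r} = ⊤ := by
  have := (IntermediateField.adjoin.powerBasis hr).adjoin_gen_eq_top
  rwa [IntermediateField.adjoin.powerBasis_gen] at this

lemma IntermediateField.adjoin_gen_inv_eq_top {r : ℝ} (hr : IsIntegral ℚ r) :
    Algebra.adjoin ℚ {(IntermediateField.AdjoinSimple.gen ℚ r)⁻¹} = ⊤ := by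
  rw [eq_top_iff, ← IntermediateField.adjoin_gen_eq_top hr]
  refine Algebra.adjoin_le (Set.singleton_subset_iff.2 ?_)
  have hint : IsIntegral ℚ (IntermediateField.AdjoinSimple.gen ℚ r) :=
    (IntermediateField.AdjoinSimple.isIntegral_gen ℚ r).2 hr
  exact hint.mem_of_inv_mem (Algebra.subset_adjoin rfl)

namespace IET

variable {N : ℕ} (E : IET N)

/-- The coefficient of the `j`-th length in the `i`-th translation. -/
def translationCoeff (i j : Fin N) : ℤ :=
  (if E.perm j < E.perm i then 1 else 0) - (if j < i then 1 else 0)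

lemma translationCoeff_swap (i j : Fin N) :
    E.translationCoeff j i = -E.translationCoeff i j := by
  unfold translationCoeff
  rcases lt_trichotomy i j with h | rfl | h
  · rcases lt_or_gt_of_ne (E.perm.injective.ne h.ne) with h' | h' <;>
      simp [h, h', h.not_gt, h'.not_gt]
  · simp
  · rcases lt_or_gt_of_ne (E.perm.injective.ne h.ne) with h' | h' <;>
      simp [h, h', h.not_gt, h'.not_gt]

lemma translation_eq_sum (i : Fin N) :
    E.translation i = ∑ j, (E.translationCoeff i j : ℝ) * E.length j := by
  simp only [translation, imageLeft, left, translationCoeff, Finset.sum_filter,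
    ← Finset.sum_sub_distrib]
  refine Finset.sum_congr rfl fun j _ => ?_
  push_cast
  rw [sub_mul, ite_mul, ite_mul, one_mul, zero_mul]

lemma rank_le : E.rank ≤ N :=
  (finrank_range_le_card E.length).trans_eq (Fintype.card_fin N)

variable {E} in
lemma UniquelyErgodic.exists_translation_ne_zero (hE : E.UniquelyErgodic) :
    ∃ i, E.translation i ≠ 0 := by
  have h0 : (0 : ℝ) ∈ Set.Ico (0 : ℝ) 1 := ⟨le_rfl, one_pos⟩
  obtain ⟨i, hi⟩ := E.exists_mem_atom h0
  refine ⟨i, fun hz => hE.iterate_ne_self h0 one_pos ?_⟩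
  rw [Function.iterate_one, map_of_mem_atom hi, hz, add_zero]

lemma nonempty_index {N : ℕ} (E : IET N) : Nonempty (Fin N) :=
  (E.exists_mem_atom (x := 0) ⟨le_rfl, one_pos⟩).nonempty

namespace IsRenormalization

variable {E} {ρ a : ℝ} {σ : Fin N → List (Fin N)} (h : E.IsRenormalization ρ a σ)
  (hE : E.UniquelyErgodic)
include h hE

lemma sum_incidenceMatrix_mul_length (j : Fin N) :
    ∑ i, (incidenceMatrix σ j i : ℝ) * E.length i = ρ⁻¹ * E.length j := by
  rw [h.length_eq_sum hE j, inv_mul_cancel_left₀ h.ratio_pos.ne']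

/-- The translations generate a nonzero module that is stable under multiplication by the ratio. -/
lemma isIntegral_ratio : IsIntegral ℤ ρ := by
  obtain ⟨i, hi⟩ := hE.exists_translation_ne_zero
  have hmem : ∀ j, E.translation j ∈ Submodule.span ℤ (Set.range E.translation) := fun j =>
    Submodule.subset_span ⟨j, rfl⟩
  refine isIntegral_of_smul_mem_submodule (Submodule.span ℤ (Set.range E.translation)) ?_
    (Submodule.fg_span (Set.finite_range _)) ρ ?_
  · exact fun h0 => hi (by simpa [h0] using hmem i)
  · intro x hx
    induction hx using Submodule.span_induction with
    | mem x hx =>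
      obtain ⟨j, rfl⟩ := hx
      rw [smul_eq_mul, h.ratio_mul_translation]
      refine sum_mem fun k _ => ?_
      rw [← zsmul_eq_mul]
      exact Submodule.smul_mem _ _ (hmem k)
    | zero => simp
    | add x y _ _ hx hy => rw [smul_add]; exact add_mem hx hy
    | smul c x _ hx => rw [smul_comm]; exact Submodule.smul_mem _ _ hx

lemma exists_unit : ∃ u : (Algebra.adjoin ℤ {ρ⁻¹})ˣ,
    ((u : Algebra.adjoin ℤ {ρ⁻¹}) : ℝ) = ρ := by
  have hρ := h.ratio_pos.ne'
  exact ⟨⟨⟨ρ, (h.isIntegral_ratio hE).mem_adjoin_int_inv hρ⟩,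
    ⟨ρ⁻¹, Algebra.subset_adjoin rfl⟩, Subtype.ext (mul_inv_cancel₀ hρ),
    Subtype.ext (inv_mul_cancel₀ hρ)⟩, rfl⟩

/-- The eigenspace of `ρ⁻¹` is a line, so it is spanned by an eigenvector over `ℚ(ρ)`, which becomes
the length vector after division by the sum of its entries. -/
lemma length_mem (i : Fin N) : E.length i ∈ ℚ⟮ρ⟯ := by
  have hρ := h.ratio_pos
  have hMl := h.sum_incidenceMatrix_mul_length hE
  set M := incidenceMatrix σ
  set r := IntermediateField.AdjoinSimple.gen ℚ ρ with hr
  set A : Matrix (Fin N) (Fin N) ℚ⟮ρ⟯ := M.map (Int.cast) - r⁻¹ • 1 with hA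
  have hdet : A.det = 0 := by
    have hmap : (A.map (algebraMap ℚ⟮ρ⟯ ℝ)).det = 0 := by
      refine Matrix.exists_mulVec_eq_zero_iff.1 ⟨E.length, fun h0 => ?_, funext fun j => ?_⟩
      · exact (E.length_pos i).ne' (congrFun h0 i)
      · have hAj : ∀ k, A.map (algebraMap ℚ⟮ρ⟯ ℝ) j k =
            (M j k : ℝ) - ρ⁻¹ * (1 : Matrix (Fin N) (Fin N) ℝ) j k := by
          intro k
          simp only [hA, Matrix.map_apply, Matrix.sub_apply, Matrix.smul_apply, Matrix.one_apply,
            smul_eq_mul, map_sub, map_intCast, map_mul, map_inv₀]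
          congr 2
          split_ifs <;> simp
        simp only [Matrix.mulVec, dotProduct, hAj, sub_mul, Finset.sum_sub_distrib, hMl]
        simp [Matrix.one_apply]
    have := RingHom.map_det (algebraMap ℚ⟮ρ⟯ ℝ) A
    rw [RingHom.mapMatrix_apply, hmap] at this
    exact (map_eq_zero _).1 this
  obtain ⟨w, hw0, hw⟩ := Matrix.exists_mulVec_eq_zero_iff.2 hdet
  have hMw : ∀ j, ∑ k, (M j k : ℝ) * (w k : ℝ) = ρ⁻¹ * (w j : ℝ) := by
    intro j
    have h1 : ∑ k, (M j k : ℚ⟮ρ⟯) * w k = r⁻¹ * w j := by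
      have := congrFun hw j
      rw [hA, Matrix.sub_mulVec, Matrix.smul_mulVec, Matrix.one_mulVec] at this
      exact sub_eq_zero.1 this
    have := congrArg (algebraMap ℚ⟮ρ⟯ ℝ) h1
    simpa [hr] using this
  have hwne : (fun j => (w j : ℝ)) ≠ 0 := fun h0 => hw0 (funext fun j => by
    simpa using congrFun h0 j)
  obtain ⟨c, hc⟩ := (h.isPrimitive hE).eq_smul_of_eigenvector E.length_pos (inv_pos.2 hρ) hMl
    hwne hMw
  have hc0 : c ≠ 0 := fun h0 => hwne (funext fun j => by simp [hc j, h0])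
  have hcmem : c ∈ ℚ⟮ρ⟯ := by
    have : c = ∑ j, (w j : ℝ) := by
      simp only [hc, ← Finset.mul_sum, E.sum_length, mul_one]
    rw [this]
    exact sum_mem fun j _ => (w j).2
  have : E.length i = c⁻¹ * w i := by rw [hc i, inv_mul_cancel_left₀ hc0]
  rw [this]
  exact mul_mem (inv_mem hcmem) (w i).2

lemma lengthField_eq : E.lengthField = ℚ⟮ρ⟯ := by
  refine le_antisymm (IntermediateField.adjoin_le_iff.2 ?_)
    (IntermediateField.adjoin_le_iff.2 (Set.singleton_subset_iff.2 ?_))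
  · rintro _ ⟨i, rfl⟩
    exact h.length_mem hE i
  · have hsum : ρ⁻¹ = ∑ j, ∑ i, (incidenceMatrix σ j i : ℝ) * E.length i := by
      simp only [h.sum_incidenceMatrix_mul_length hE, ← Finset.mul_sum, E.sum_length, mul_one]
    have hmem : ρ⁻¹ ∈ E.lengthField := by
      rw [hsum]
      refine sum_mem fun j _ => sum_mem fun i _ => mul_mem (intCast_mem _ _) ?_
      exact IntermediateField.subset_adjoin _ _ ⟨i, rfl⟩
    simpa using inv_mem hmem

lemma isIntegral_ratio_rat : IsIntegral ℚ ρ := (h.isIntegral_ratio hE).tower_top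

lemma lengthModule_le {x : ℝ} (hx : x ∈ E.lengthModule) : x ∈ ℚ⟮ρ⟯ := by
  induction hx using Submodule.span_induction with
  | mem x hx => obtain ⟨i, rfl⟩ := hx; exact h.length_mem hE i
  | zero => exact zero_mem _
  | add x y _ _ hx hy => exact add_mem hx hy
  | smul c x _ hx => rw [zsmul_eq_mul]; exact mul_mem (intCast_mem _ _) hx

/-- The lengths as elements of the field generated by the ratio. -/
def fieldLength (i : Fin N) : ℚ⟮ρ⟯ := ⟨E.length i, h.length_mem hE i⟩

/-- The translations as elements of the field generated by the ratio. -/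
def fieldTranslation (i : Fin N) : ℚ⟮ρ⟯ :=
  ⟨E.translation i, h.lengthModule_le hE (E.translation_mem i)⟩

lemma fieldLength_eq_sum (j : Fin N) :
    h.fieldLength hE j = IntermediateField.AdjoinSimple.gen ℚ ρ *
      ∑ i, (incidenceMatrix σ j i : ℚ⟮ρ⟯) * h.fieldLength hE i := by
  apply Subtype.ext
  push_cast
  exact h.length_eq_sum hE j

lemma gen_mul_fieldTranslation (i : Fin N) :
    IntermediateField.AdjoinSimple.gen ℚ ρ * h.fieldTranslation hE i =
      ∑ j, (incidenceMatrix σ j i : ℚ⟮ρ⟯) * h.fieldTranslation hE j := by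
  apply Subtype.ext
  push_cast
  exact h.ratio_mul_translation i

lemma fieldTranslation_eq_sum (i : Fin N) :
    h.fieldTranslation hE i = ∑ j, (E.translationCoeff i j : ℚ⟮ρ⟯) * h.fieldLength hE j := by
  apply Subtype.ext
  push_cast
  exact E.translation_eq_sum i

omit h hE in
lemma gen_ne_zero (hρ : ρ ≠ 0) : IntermediateField.AdjoinSimple.gen ℚ ρ ≠ 0 := fun h0 =>
  hρ (congrArg (algebraMap ℚ⟮ρ⟯ ℝ) h0)

lemma span_fieldLength : Submodule.span ℚ (Set.range (h.fieldLength hE)) = ⊤ := by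
  obtain ⟨i⟩ := nonempty_index E
  have hmem : ∀ j, h.fieldLength hE j ∈ Submodule.span ℚ (Set.range (h.fieldLength hE)) :=
    fun j => Submodule.subset_span ⟨j, rfl⟩
  refine Submodule.eq_top_of_mul_mem
    (IntermediateField.adjoin_gen_inv_eq_top (h.isIntegral_ratio_rat hE)) _ (hmem i)
    (fun h0 => (E.length_pos i).ne' (congrArg Subtype.val h0)) fun x hx => ?_
  induction hx using Submodule.span_induction with
  | mem x hx =>
    obtain ⟨j, rfl⟩ := hx
    rw [h.fieldLength_eq_sum hE j, inv_mul_cancel_left₀ (gen_ne_zero h.ratio_pos.ne')]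
    refine sum_mem fun k _ => ?_
    rw [← zsmul_eq_mul]
    exact zsmul_mem (hmem k) _
  | zero => simp
  | add x y _ _ hx hy => rw [mul_add]; exact add_mem hx hy
  | smul c x _ hx => rw [mul_smul_comm]; exact Submodule.smul_mem _ _ hx

lemma span_fieldTranslation :
    Submodule.span ℚ (Set.range (h.fieldTranslation hE)) = ⊤ := by
  obtain ⟨i, hi⟩ := hE.exists_translation_ne_zero
  have hmem : ∀ j, h.fieldTranslation hE j ∈
      Submodule.span ℚ (Set.range (h.fieldTranslation hE)) :=
    fun j => Submodule.subset_span ⟨j, rfl⟩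
  refine Submodule.eq_top_of_mul_mem
    (IntermediateField.adjoin_gen_eq_top (h.isIntegral_ratio_rat hE)) _ (hmem i)
    (fun h0 => hi (congrArg Subtype.val h0)) fun x hx => ?_
  induction hx using Submodule.span_induction with
  | mem x hx =>
    obtain ⟨j, rfl⟩ := hx
    rw [h.gen_mul_fieldTranslation hE j]
    refine sum_mem fun k _ => ?_
    rw [← zsmul_eq_mul]
    exact zsmul_mem (hmem k) _
  | zero => simp
  | add x y _ _ hx hy => rw [mul_add]; exact add_mem hx hy
  | smul c x _ hx => rw [mul_smul_comm]; exact Submodule.smul_mem _ _ hx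

/-! ### The rank and the drift vector -/

/-- A basis of the length module is a rational basis of the field. -/
lemma exists_fieldBasis {n : ℕ} (b : Module.Basis (Fin n) ℤ E.lengthModule) :
    ∃ B : Module.Basis (Fin n) ℚ ℚ⟮ρ⟯, ∀ (x : E.lengthModule) (k : Fin n),
      B.repr ⟨x, h.lengthModule_le hE x.2⟩ k = (b.repr x k : ℚ) := by
  set v : Fin n → ℚ⟮ρ⟯ := fun k => ⟨b k, h.lengthModule_le hE (b k).2⟩ with hv
  have hli : LinearIndependent ℚ v := by
    have h1 : LinearIndependent ℤ fun k => (b k : ℝ) :=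
      b.linearIndependent.map' E.lengthModule.subtype (Submodule.ker_subtype _)
    rw [LinearIndependent.iff_fractionRing ℤ ℚ] at h1
    exact LinearIndependent.of_comp (ℚ⟮ρ⟯).val.toLinearMap h1
  have hrepr : ∀ x : E.lengthModule, (⟨x, h.lengthModule_le hE x.2⟩ : ℚ⟮ρ⟯) =
      ∑ k, (b.repr x k : ℚ) • v k := by
    intro x
    apply Subtype.ext
    have := congrArg (E.lengthModule.subtype) (b.sum_repr x).symm
    rw [map_sum] at this
    simpa [hv, Algebra.smul_def] using this
  have hsp : ⊤ ≤ Submodule.span ℚ (Set.range v) := by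
    rw [← h.span_fieldLength hE, Submodule.span_le]
    rintro _ ⟨i, rfl⟩
    have := hrepr ⟨E.length i, Submodule.subset_span ⟨i, rfl⟩⟩
    rw [SetLike.mem_coe, show h.fieldLength hE i = _ from this]
    exact sum_mem fun k _ => Submodule.smul_mem _ _ (Submodule.subset_span ⟨k, rfl⟩)
  refine ⟨Module.Basis.mk hli hsp, fun x k => ?_⟩
  have hBv : ∑ k, (b.repr x k : ℚ) • v k =
      ∑ k, (b.repr x k : ℚ) • Module.Basis.mk hli hsp k := by
    simp only [Module.Basis.mk_apply]
  rw [hrepr x, hBv, Module.Basis.repr_sum_self]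

lemma finiteDimensional : FiniteDimensional ℚ ℚ⟮ρ⟯ :=
  IntermediateField.adjoin.finiteDimensional (h.isIntegral_ratio_rat hE)

lemma rank_eq_finrank : E.rank = Module.finrank ℚ ℚ⟮ρ⟯ := by
  have : Module.Finite ℤ E.lengthModule :=
    Module.Finite.iff_fg.2 (Submodule.fg_span (Set.finite_range _))
  obtain ⟨B, -⟩ := h.exists_fieldBasis hE (Module.finBasis ℤ E.lengthModule)
  rw [Module.finrank_eq_card_basis B, Fintype.card_fin, rank]

lemma drift_eq_zero_iff {n : ℕ} (b : Module.Basis (Fin n) ℤ E.lengthModule) :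
    E.drift b = 0 ↔ driftMap ℚ (h.fieldLength hE) (h.fieldTranslation hE) = 0 := by
  obtain ⟨B, hB⟩ := h.exists_fieldBasis hE b
  have hcoord : ∀ k, E.drift b k =
      (driftMap ℚ (h.fieldLength hE) (h.fieldTranslation hE) (B.dualBasis k) : ℝ) := by
    intro k
    rw [driftMap_apply, drift, Finset.sum_apply]
    push_cast
    refine Finset.sum_congr rfl fun i _ => ?_
    rw [B.dualBasis_apply, fieldTranslation, hB ⟨E.translation i, E.translation_mem i⟩ k]
    simp [fieldLength, Algebra.smul_def, mul_comm]
  constructor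
  · intro h0
    refine B.dualBasis.ext fun k => ?_
    apply Subtype.ext
    rw [← hcoord k, h0]
    simp
  · intro h0
    funext k
    rw [hcoord k, h0]
    simp

end IsRenormalization

end IET

end

theorem theorem1 {N : ℕ} (E : IET N) (hE : E.UniquelyErgodic) (ρ a : ℝ)
    (σ : Fin N → List (Fin N)) (hσ : E.IsRenormalization ρ a σ) :
    (incidenceMatrix σ).IsPrimitive ∧
    IsLargestEigenvalue (incidenceMatrix σ) ρ⁻¹ ∧
    (∃ u : (Algebra.adjoin ℤ {ρ⁻¹})ˣ, ((u : Algebra.adjoin ℤ {ρ⁻¹}) : ℝ) = ρ) ∧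
    E.lengthField = ℚ⟮ρ⟯ ∧
    E.HasMaximalRank ∧
    IsAlgebraic ℚ ρ ∧
    E.rank = (minpoly ℚ ρ).natDegree ∧
    ∀ b : Module.Basis (Fin E.rank) ℤ E.lengthModule,
      (E.drift b ≠ 0 → Even E.rank ∧ E.rank ≤ N) ∧
      (E.drift b = 0 → 2 * E.rank ≤ N) := by
  have hint := hσ.isIntegral_ratio_rat hE
  have hfd := hσ.finiteDimensional hE
  have hrank := hσ.rank_eq_finrank hE
  refine ⟨hσ.isPrimitive hE, ?_, hσ.exists_unit hE, hσ.lengthField_eq hE, ?_, hint.isAlgebraic,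
    hrank.trans (IntermediateField.adjoin.finrank hint), fun b => ⟨fun hb => ⟨?_, E.rank_le⟩,
    fun hb => ?_⟩⟩
  · obtain ⟨i⟩ := IET.nonempty_index E
    exact (hσ.isPrimitive hE).isLargestEigenvalue E.length_pos
      (fun h0 => (E.length_pos i).ne' (congrFun h0 i)) (inv_pos.2 hσ.ratio_pos)
      (hσ.sum_incidenceMatrix_mul_length hE)
  · rw [IET.HasMaximalRank, hσ.lengthField_eq hE]
    exact ⟨hfd, hrank⟩
  · rw [Ne, hσ.drift_eq_zero_iff hE b] at hb
    rw [hrank]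
    exact even_finrank_of_driftMap_injective (fun i j => E.translationCoeff_swap i j)
      (hσ.fieldTranslation_eq_sum hE)
      ((driftMap_injective_or_eq_zero (IET.IsRenormalization.gen_ne_zero hσ.ratio_pos.ne')
        (IntermediateField.adjoin_gen_eq_top hint) (hσ.gen_mul_fieldTranslation hE)
        (hσ.fieldLength_eq_sum hE)).resolve_right hb)
  · rw [hσ.drift_eq_zero_iff hE b] at hb
    have := two_mul_finrank_le_of_driftMap_eq_zero (hσ.span_fieldLength hE)
      (hσ.span_fieldTranslation hE) hb
    rwa [← hrank, Fintype.card_fin] at this
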